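/- **Theorem 5.18 (automorphisms and truth values).** Let $A$ be a von Neumann algebra, $h:A\to A$ a $*$-automorphism, $\psi$ a state on $A$ (a positive normalised linear functional), $a\in A$ self-adjoint and $\Delta\subseteq\mathbb R$ a Borel set with spectral projection $\chi_\Delta(a)$. Let $\mathcal C$ be the set of contexts (abelian von Neumann subalgebras) of $A$, ordered by inclusion. For every $C\in\mathcal C$ the image $h[C]$ is again a context. Let $\Sigma_C$ be the Gelfand spectrum of $C$, and let $\mu^C:\mathcal O\Sigma_C\to[0,1]$ be the probability valuation which represents the state $\psi|_C$ (Riesz–Markov). *Contravariant model.* Let $\Sigma_\downarrow=\coprod_{C}\Sigma_C$, where $U=\coprod_C U_C$ is open iff each $U_C\subseteq\Sigma_C$ is open and $\lambda\in U_C$, $D\subseteq C$ imply $\lambda|_D\in U_D$. Let $\hat h^*\Sigma_\downarrow=\coprod_C\Sigma_{h[C]}$ (over $C\in\mathcal C$) be its pullback along $\hat h:C\mapsto h[C]$, with open sets defined in the same way, and let $\Sigma(h):\hat h^*\Sigma_\downarrow\to\Sigma_\downarrow$ be the continuous map $(C,\lambda)\mapsto(C,\lambda\circ h|_C)$. In the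 topos $[\mathcal C^{op},\mathbf{Set}]$ let $\mathcal O\underline\Sigma$ and $\mathcal OH^*\underline\Sigma$ be the presheaves whose sections over $C$ are the open subsets of the parts of $\Sigma_\downarrow$ and $\hat h^*\Sigma_\downarrow$ over $\downarrow C$, and let $\underline{[0,1]}_l$ be the presheaf whose sections over $C$ are the order-reversing functions $\downarrow C\to[0,1]$. Taking preimages under $\Sigma(h)$ gives $\underline\Sigma(h)^{-1}:\mathcal O\underline\Sigma\to\mathcal OH^*\underline\Sigma$; the state gives the valuations $\underline\mu:\mathcal O\underline\Sigma\to\underline{[0,1]}_l$, $\underline\mu_C(U)(D)=\mu^D(U_D)$, and $\underline\mu_h:\mathcal OH^*\underline\Sigma\to\underline{[0,1]}_l$, $(\underline\mu_h)_C(U)(D)=\mu^{h[D]}(U_D)$. The elementary proposition $\underline{[a\in\Delta]}:\underline 1\to\mathcal O\underline\Sigma$ is given by the open set $\{(C,\lambda)\mid\lambda(\delta^o(\chi_\Delta(a))_C)=1\}$, where $\delta^o(p)_C=\bigwedge\{q\in\mathrm{Proj}(C)\mid q\ge p\}$. Let $\underline 1$ also denote the constant function $1$ in $\underline{[0,1]}_l$,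 and write $C\Vdash s=t$ if the global elements $s$ and $t$ have the same component at $C$. Then for every $C\in\mathcal C$ $$C\Vdash\underline\mu_h\bigl(\underline\Sigma(h)^{-1}(\underline{[a\in\Delta]})\bigr)=\underline 1\quad\Longleftrightarrow\quad h[C]\Vdash\underline\mu\bigl(\underline{[h(a)\in\Delta]}\bigr)=\underline 1 ,$$ and consequently, if $S$ is the sieve of all contexts which force the equation on the left, then $h[S]=\{h[C]\mid C\in S\}$ is the sieve of all contexts which force $\underline\mu(\underline{[h(a)\in\Delta]})=\underline 1$. *Covariant model.* The same two statements hold in $[\mathcal C,\mathbf{Set}]$, with cosieves instead of sieves, where now: in the definition of the open sets of $\Sigma_\uparrow=\coprod_C\Sigma_C$ and $\hat h^*\Sigma_\uparrow$ the condition on restrictions is replaced by "$\lambda\in\Sigma_C$, $D\subseteq C$ and $\lambda|_D\in U_D$ imply $\lambda\in U_C$" (for $\lambda\in\Sigma_{h[C]}$ and $\lambda|_{h[D]}$ in the case of the pullback); $\downarrow C$ is replaced by $\uparrow C$, and order-reversing by order-preserving; and $\underline{[a\in\Delta]}$ is given by $\{(C,\lambda)\mid\lambda(\delta^i(\chi_\Delta(a))_C)=1\}$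 with inner daseinisation $\delta^i(p)_C=\bigvee\{q\in\mathrm{Proj}(C)\mid q\le p\}$. -/

import Mathlib

open MeasureTheory CategoryTheory Opposite TopologicalSpace
open scoped InnerProductSpace ComplexOrder CompactlySupported

section SpectralProjection
variable {H : Type*} [NormedAddCommGroup H] [InnerProductSpace ℂ H] [CompleteSpace H]

/-- A bounded quadratic form is represented by a bounded operator. -/
theorem exists_operator_of_quadratic (q : H → ℝ) (h0 : ∀ x, 0 ≤ q x) (h1 : ∀ x, q x ≤ ‖x‖ ^ 2)
    (hadd : ∀ x y z, q (x + y + z) + q x + q y + q z = q (x + y) + q (y + z) + q (x + z))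
    (hsmul : ∀ (t : ℝ), 0 ≤ t → ∀ x y,
      q ((t : ℂ) • x + y) + t * q x + t * q y = t ^ 2 * q x + q y + t * q (x + y))
    (hI : ∀ x, q (Complex.I • x) = q x) :
    ∃ E : H →L[ℂ] H, ∀ x, ⟪x, E x⟫_ℂ = (q x : ℂ) := by
  have q0 : q 0 = 0 := le_antisymm (by simpa using h1 0) (h0 0)
  let R : H → H → ℝ := fun x y => (q (x + y) - q x - q y) / 2
  have Rsymm : ∀ x y, R x y = R y x := fun x y => by simp only [R, add_comm x y]; ring
  have Radd : ∀ x y z, R (x + y) z = R x z + R y z := fun x y z => by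
    have := hadd x y z
    simp only [R]; linarith
  have R0 : ∀ y, R 0 y = 0 := fun y => by simp [R, q0]
  have Rneg : ∀ x y, R (-x) y = - R x y := fun x y => by
    have := Radd x (-x) y
    rw [add_neg_cancel, R0] at this; linarith
  have Rpos : ∀ t : ℝ, 0 ≤ t → ∀ x y, R ((t : ℂ) • x) y = t * R x y := fun t ht x y => by
    have a1 := hsmul t ht x y
    have a2 := hsmul t ht x 0
    simp only [add_zero, q0] at a2
    simp only [R]; linarith
  have Rsm : ∀ t : ℝ, ∀ x y, R ((t : ℂ) • x) y = t * R x y := fun t x y => by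
    rcases le_total 0 t with ht | ht
    · exact Rpos t ht x y
    · have := Rpos (-t) (by linarith) x y
      rw [Complex.ofReal_neg, neg_smul, Rneg] at this; linarith
  have RI : ∀ x y, R (Complex.I • x) (Complex.I • y) = R x y := fun x y => by
    simp only [R, ← smul_add, hI]
  have II : ∀ x : H, Complex.I • Complex.I • x = -x := fun x => by
    rw [smul_smul, Complex.I_mul_I, neg_one_smul]
  have RI' : ∀ x y, R (Complex.I • x) y = - R x (Complex.I • y) := fun x y => by
    rw [← RI x (Complex.I • y), II, Rsymm _ (-y), Rneg, Rsymm y]; ring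
  have Radd' : ∀ x y z, R x (y + z) = R x y + R x z := fun x y z => by
    rw [Rsymm, Radd, Rsymm y, Rsymm z]
  have Rsm' : ∀ t : ℝ, ∀ x y, R x ((t : ℂ) • y) = t * R x y := fun t x y => by
    rw [Rsymm, Rsm, Rsymm y]
  have Rneg' : ∀ x y, R x (-y) = - R x y := fun x y => by rw [Rsymm, Rneg, Rsymm y]
  have Rself : ∀ x, R x x = q x := fun x => by
    have a1 := hsmul 1 zero_le_one x x
    have a2 := hsmul 2 zero_le_two x 0
    simp only [add_zero, q0] at a2
    have : x + x = ((2 : ℝ) : ℂ) • x := by rw [Complex.ofReal_ofNat, two_smul]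
    simp only [R, this]; linarith
  have Rbd1 : ∀ x y, ‖x‖ ≤ 1 → ‖y‖ ≤ 1 → |R x y| ≤ 3 := fun x y hx hy => by
    have b1 := h1 x
    have b2 := h1 y
    have b3 := h1 (x + y)
    have b4 : ‖x + y‖ ≤ 2 := (norm_add_le _ _).trans (by linarith)
    have c1 : ‖x‖ ^ 2 ≤ 1 := pow_le_one₀ (norm_nonneg _) hx
    have c2 : ‖y‖ ^ 2 ≤ 1 := pow_le_one₀ (norm_nonneg _) hy
    have c3 : ‖x + y‖ ^ 2 ≤ 2 ^ 2 := pow_le_pow_left₀ (norm_nonneg _) b4 2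
    have d1 := h0 x
    have d2 := h0 y
    have d3 := h0 (x + y)
    simp only [R]
    rw [abs_le]; constructor <;> linarith
  have unit : ∀ x : H, ∃ u : H, ‖u‖ ≤ 1 ∧ x = ((‖x‖ : ℝ) : ℂ) • u := fun x => by
    by_cases hx : x = 0
    · exact ⟨0, by simp, by simp [hx]⟩
    · refine ⟨((‖x‖⁻¹ : ℝ) : ℂ) • x, ?_, ?_⟩
      · rw [norm_smul]; simp [hx]
      · rw [smul_smul, ← Complex.ofReal_mul, mul_inv_cancel₀ (norm_ne_zero_iff.mpr hx)]; simp
  have Rbd : ∀ x y, |R x y| ≤ 3 * ‖x‖ * ‖y‖ := fun x y => by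
    obtain ⟨u, hu, hxu⟩ := unit x
    obtain ⟨v, hv, hyv⟩ := unit y
    have : R x y = ‖x‖ * (‖y‖ * R u v) := by
      conv_lhs => rw [hxu, hyv, Rsm, Rsm']
    rw [this, abs_mul, abs_mul, abs_norm, abs_norm]
    have := Rbd1 u v hu hv
    nlinarith [mul_nonneg (norm_nonneg x) (norm_nonneg y)]
  let B : H → H → ℂ := fun x y => (R x y : ℂ) - Complex.I * (R x (Complex.I • y) : ℂ)
  have decomp : ∀ (c : ℂ) (x : H), c • x = (c.re : ℂ) • x + (c.im : ℂ) • (Complex.I • x) :=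
    fun c x => by rw [smul_smul, ← add_smul, Complex.re_add_im]
  have Bsm' : ∀ (c : ℂ) x y, B x (c • y) = c * B x y := fun c x y => by
    have e1 : R x (c • y) = c.re * R x y + c.im * R x (Complex.I • y) := by
      rw [decomp c y, Radd', Rsm', Rsm']
    have e2 : R x (Complex.I • c • y) = c.re * R x (Complex.I • y) - c.im * R x y := by
      rw [smul_comm, decomp c (Complex.I • y), Radd', Rsm', Rsm', II, Rneg']; ring
    simp only [B, e1, e2]
    apply Complex.ext <;> simp <;> ring
  have Bsm : ∀ (c : ℂ) x y, B (c • x) y = (starRingEnd ℂ) c * B x y := fun c x y => by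
    have e1 : ∀ y, R (c • x) y = c.re * R x y - c.im * R x (Complex.I • y) := fun y => by
      rw [decomp c x, Radd, Rsm, Rsm, RI']; ring
    have e2 : R x (Complex.I • Complex.I • y) = - R x y := by rw [II, Rneg']
    simp only [B, e1, e2]
    apply Complex.ext <;> simp <;> ring
  have Bbd : ∀ x y, ‖B x y‖ ≤ 6 * ‖x‖ * ‖y‖ := fun x y => by
    refine (norm_sub_le _ _).trans ?_
    have a1 := Rbd x y
    have a2 := Rbd x (Complex.I • y)
    rw [norm_smul, Complex.norm_I, one_mul] at a2
    rw [norm_mul, Complex.norm_I, one_mul, Complex.norm_real, Complex.norm_real,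
      Real.norm_eq_abs, Real.norm_eq_abs]
    linarith
  let Bl : H →ₗ⋆[ℂ] H →ₗ[ℂ] ℂ := LinearMap.mk₂'ₛₗ (starRingEnd ℂ) (RingHom.id ℂ) B
    (fun x y z => by simp only [B, Radd]; push_cast; ring)
    (fun c x y => by simp only [Bsm, smul_eq_mul])
    (fun x y z => by simp only [B, smul_add, Radd']; push_cast; ring)
    (fun c x y => by simp only [Bsm', RingHom.id_apply, smul_eq_mul])
  let Bc : H →L⋆[ℂ] H →L[ℂ] ℂ := Bl.mkContinuous₂ 6 Bbd
  refine ⟨(InnerProductSpace.continuousLinearMapOfBilin Bc).adjoint, fun x => ?_⟩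
  rw [ContinuousLinearMap.adjoint_inner_right, InnerProductSpace.continuousLinearMapOfBilin_apply]
  change B x x = _
  have : R x (Complex.I • x) = 0 := by
    have := RI' x x
    rw [Rsymm] at this; linarith
  simp [B, Rself, this]

theorem measureReal_add_apply' {X : Type*} [MeasurableSpace X] (μ ν : Measure X)
    [IsFiniteMeasure μ] [IsFiniteMeasure ν] (s : Set X) :
    (μ + ν).real s = μ.real s + ν.real s :=
  measureReal_add_apply

/-- The positive linear functional `f ↦ ⟪x, f(a) x⟫` on `C_c(ℝ)`. -/
noncomputable def spectralFunctional (a : H →L[ℂ] H) (x : H) : C_c(ℝ, ℝ) →ₚ[ℝ] ℝ :=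
  PositiveLinearMap.mk₀
    { toFun := fun f => (⟪x, cfc (f : ℝ → ℝ) a x⟫_ℂ).re
      map_add' := fun f g => by
        have : cfc (fun t => f t + g t) a = cfc (f : ℝ → ℝ) a + cfc (g : ℝ → ℝ) a :=
          cfc_add a f g
        change (⟪x, cfc (fun t => f t + g t) a x⟫_ℂ).re = _
        rw [this]; simp
      map_smul' := fun c f => by
        have : cfc (fun t => c * f t) a = c • cfc (f : ℝ → ℝ) a :=
          cfc_const_mul c f a
        change (⟪x, cfc (fun t => c * f t) a x⟫_ℂ).re = _
        rw [this]
        have : (c • cfc (f : ℝ → ℝ) a) x = (c : ℂ) • (cfc (f : ℝ → ℝ) a x) := by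
          simp
        rw [this, inner_smul_right]; simp }
    (fun f hf => by
      have : 0 ≤ cfc (f : ℝ → ℝ) a := cfc_nonneg fun t _ => hf t
      rw [ContinuousLinearMap.nonneg_iff_isPositive] at this
      have := this.inner_nonneg_right x
      exact (Complex.le_def.mp this).1)

/-- The spectral measure `μ_x` of `a` at the vector `x`: the Riesz–Markov measure with
`∫ f ∂μ_x = ⟪x, f(a) x⟫` for all `f ∈ C_c(ℝ)`. -/
noncomputable def vectorSpectralMeasure (a : H →L[ℂ] H) (x : H) : Measure ℝ :=
  RealRMK.rieszMeasure (spectralFunctional a x)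

theorem vectorSpectralMeasure_univ_le (a : H →L[ℂ] H) (x : H) :
    vectorSpectralMeasure a x Set.univ ≤ ENNReal.ofReal (‖x‖ ^ 2) := by
  have : (vectorSpectralMeasure a x).Regular := by
    unfold vectorSpectralMeasure; infer_instance
  rw [isOpen_univ.measure_eq_iSup_isCompact]
  refine iSup_le fun K => iSup_le fun _ => iSup_le fun hK => ?_
  obtain ⟨f, hf1, hf2, -, hf3⟩ :=
    exists_continuousMap_one_of_isCompact_subset_isOpen hK isOpen_univ (Set.subset_univ K)
  let g : C_c(ℝ, ℝ) := ⟨f, hasCompactSupport_def.mpr hf2⟩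
  refine (RealRMK.rieszMeasure_le_of_eq_one (spectralFunctional a x) (f := g)
    (fun t => (hf3 t).1) hK (fun t ht => hf1 ht)).trans (ENNReal.ofReal_le_ofReal ?_)
  have hle : cfc (g : ℝ → ℝ) a ≤ 1 := cfc_le_one _ a fun t _ => (hf3 t).2
  rw [ContinuousLinearMap.le_def] at hle
  have := hle.inner_nonneg_right x
  have h2 := (Complex.le_def.mp this).1
  have h3 : (⟪x, x⟫_ℂ).re = ‖x‖ ^ 2 := inner_self_eq_norm_sq (𝕜 := ℂ) x
  simp only [sub_apply, one_apply_eq_self, inner_sub_right,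
    Complex.sub_re, Complex.zero_re, h3] at h2
  change (⟪x, cfc (g : ℝ → ℝ) a x⟫_ℂ).re ≤ _
  linarith

instance (a : H →L[ℂ] H) (x : H) : IsFiniteMeasure (vectorSpectralMeasure a x) :=
  ⟨(vectorSpectralMeasure_univ_le a x).trans_lt ENNReal.ofReal_lt_top⟩

theorem integral_vectorSpectralMeasure (a : H →L[ℂ] H) (x : H) (f : C_c(ℝ, ℝ)) :
    ∫ t, f t ∂(vectorSpectralMeasure a x) = (⟪x, cfc (f : ℝ → ℝ) a x⟫_ℂ).re :=
  RealRMK.integral_rieszMeasure (spectralFunctional a x) f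

theorem exists_spectralProjection (a : H →L[ℂ] H) (Δ : Set ℝ) :
    ∃ E : H →L[ℂ] H, ∀ x, ⟪x, E x⟫_ℂ = ((vectorSpectralMeasure a x).real Δ : ℂ) := by
  apply exists_operator_of_quadratic
  · exact fun x => measureReal_nonneg
  · intro x
    refine (measureReal_mono (Set.subset_univ _)).trans ?_
    exact ENNReal.toReal_le_of_le_ofReal (by positivity) (vectorSpectralMeasure_univ_le a x)
  · intro x y z
    have : vectorSpectralMeasure a (x + y + z) + vectorSpectralMeasure a x
        + vectorSpectralMeasure a y + vectorSpectralMeasure a z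
        = vectorSpectralMeasure a (x + y) + vectorSpectralMeasure a (y + z)
        + vectorSpectralMeasure a (x + z) := by
      refine Measure.ext_of_integral_eq_on_compactlySupported fun f => ?_
      iterate 5 rw [integral_add_measure f.integrable f.integrable]
      simp only [integral_vectorSpectralMeasure, map_add, inner_add_left, inner_add_right,
        Complex.add_re]
      ring
    have := congrArg (fun m : Measure ℝ => m.real Δ) this
    simpa only [measureReal_add_apply'] using this
  · intro t ht x y
    lift t to NNReal using ht
    have : vectorSpectralMeasure a (((t : ℝ) : ℂ) • x + y) + t • vectorSpectralMeasure a x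
        + t • vectorSpectralMeasure a y
        = t ^ 2 • vectorSpectralMeasure a x + vectorSpectralMeasure a y
        + t • vectorSpectralMeasure a (x + y) := by
      refine Measure.ext_of_integral_eq_on_compactlySupported fun f => ?_
      iterate 4 rw [integral_add_measure f.integrable f.integrable]
      simp only [integral_smul_nnreal_measure, integral_vectorSpectralMeasure, map_add, map_smul,
        inner_add_left, inner_add_right, inner_smul_left, inner_smul_right, Complex.add_re]
      simp [NNReal.smul_def]
      ring
    have := congrArg (fun m : Measure ℝ => m.real Δ) this
    simpa only [measureReal_add_apply', measureReal_nnreal_smul_apply, NNReal.coe_pow] using this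
  · intro x
    have : vectorSpectralMeasure a (Complex.I • x) = vectorSpectralMeasure a x := by
      refine Measure.ext_of_integral_eq_on_compactlySupported fun f => ?_
      simp only [integral_vectorSpectralMeasure, map_smul, inner_smul_left, inner_smul_right]
      simp
    rw [this]

/-- The spectral projection `χ_Δ(a)` of a self-adjoint operator `a`: the bounded operator with
`⟪x, χ_Δ(a) x⟫ = μ_x(Δ)` for every vector `x`, where `μ_x` is the spectral measure of `a`
at `x`. -/
noncomputable def spectralProjection (a : H →L[ℂ] H) (Δ : Set ℝ) : H →L[ℂ] H :=
  Classical.choose (exists_spectralProjection a Δ)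

theorem inner_spectralProjection (a : H →L[ℂ] H) (Δ : Set ℝ) (x : H) :
    ⟪x, spectralProjection a Δ x⟫_ℂ = ((vectorSpectralMeasure a x).real Δ : ℂ) :=
  Classical.choose_spec (exists_spectralProjection a Δ) x

end SpectralProjection

universe u

section Contexts
variable {H : Type u} [NormedAddCommGroup H] [InnerProductSpace ℂ H] [CompleteSpace H]

theorem VonNeumannAlgebra.isClosed_coe (A : VonNeumannAlgebra H) :
    IsClosed (A : Set (H →L[ℂ] H)) := by
  rw [← A.centralizer_centralizer]
  exact Set.isClosed_centralizer _

/-- A context of `A`: an abelian von Neumann subalgebra of `A`. -/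
structure Context (A : VonNeumannAlgebra H) where
  toVN : VonNeumannAlgebra H
  le : toVN ≤ A
  comm : ∀ x ∈ toVN, ∀ y ∈ toVN, x * y = y * x

namespace Context
variable {A : VonNeumannAlgebra H}

/-- Contexts are ordered by inclusion. -/
instance : PartialOrder (Context A) :=
  PartialOrder.lift Context.toVN fun C D h => by cases C; cases D; cases h; rfl

/-- The underlying `*`-algebra of a context. -/
abbrev alg (C : Context A) : StarSubalgebra ℂ (H →L[ℂ] H) := C.toVN.toStarSubalgebra

instance (C : Context A) : IsClosed (C.alg : Set (H →L[ℂ] H)) := C.toVN.isClosed_coe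

noncomputable instance (C : Context A) : CommCStarAlgebra C.alg :=
  { StarSubalgebra.cstarAlgebra C.alg with
    mul_comm := fun x y => Subtype.ext (C.comm x x.2 y y.2) }

/-- The inclusion `D ⊆ C` as a `*`-homomorphism. -/
noncomputable def incl {D C : Context A} (hDC : D ≤ C) : D.alg →⋆ₐ[ℂ] C.alg :=
  StarSubalgebra.inclusion hDC

/-- The inclusion `C ⊆ A` as a `*`-homomorphism. -/
noncomputable def inclA (C : Context A) : C.alg →⋆ₐ[ℂ] A.toStarSubalgebra :=
  StarSubalgebra.inclusion C.le

/-- The Gelfand spectrum `Σ_C` of a context, with the weak-* topology. -/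
abbrev Spec (C : Context A) : Type u := WeakDual.characterSpace ℂ C.alg

noncomputable instance (C : Context A) : MeasurableSpace C.Spec := borel _
instance (C : Context A) : BorelSpace C.Spec := ⟨rfl⟩

/-- The restriction map `ρ_{CD} : Σ_C → Σ_D`, `λ ↦ λ|_D`, for `D ⊆ C`. -/
noncomputable def restr {D C : Context A} (hDC : D ≤ C) : C(C.Spec, D.Spec) :=
  WeakDual.CharacterSpace.compContinuousMap (incl hDC)

/-- The `*`-homomorphism `C(Σ_C, ℂ) ≅ C ⊆ A` given by the inverse Gelfand transform. -/
noncomputable def ofSpec (C : Context A) : C(C.Spec, ℂ) →⋆ₐ[ℂ] A.toStarSubalgebra :=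
  C.inclA.comp ((gelfandStarTransform C.alg).symm : C(C.Spec, ℂ) →⋆ₐ[ℂ] C.alg)

end Context

/-- The projections of a von Neumann algebra, with the operator order (`p ≤ q` iff `q - p` is
positive). -/
abbrev Proj (C : VonNeumannAlgebra H) : Type u := {q : H →L[ℂ] H // q ∈ C ∧ IsStarProjection q}

theorem exists_isGLB_proj' (C : VonNeumannAlgebra H) (S : Set (Proj C)) :
    ∃ g : Proj C, IsGLB S g ∧
      ∀ r : H →L[ℂ] H, IsStarProjection r → (∀ q ∈ S, r ≤ q.1) → r ≤ g.1 := by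
  let K : Submodule ℂ H := ⨅ q ∈ S, q.1.range
  have hcl : ∀ q : Proj C, IsClosed (q.1.range : Set H) := fun q => by
    exact ContinuousLinearMap.IsIdempotentElem.isClosed_range q.2.2.isIdempotentElem
  have hK : IsClosed (K : Set H) := by
    simp only [K, Submodule.coe_iInf]
    exact isClosed_iInter fun q => isClosed_iInter fun _ => hcl q
  have : CompleteSpace K := hK.completeSpace_coe
  have hmem : K.starProjection ∈ C := by
    rw [VonNeumannAlgebra.IsStarProjection.mem_iff isStarProjection_starProjection]
    intro y hy
    rw [Submodule.range_starProjection]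
    intro x hx
    simp only [K, Submodule.mem_iInf, Submodule.mem_comap] at hx ⊢
    intro q hq
    exact (VonNeumannAlgebra.IsStarProjection.mem_iff q.2.2 C).mp q.2.1 y hy (hx q hq)
  have hglb : ∀ r : H →L[ℂ] H, IsStarProjection r → (∀ q ∈ S, r ≤ q.1) →
      r ≤ K.starProjection := by
    intro r hr hrS
    obtain ⟨_, hr'⟩ := isStarProjection_iff_eq_starProjection_range.mp hr
    rw [hr', Submodule.starProjection_le_starProjection_iff]
    refine le_iInf₂ fun q hq => ?_
    obtain ⟨_, hq'⟩ := isStarProjection_iff_eq_starProjection_range.mp q.2.2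
    have : r ≤ q.1 := hrS q hq
    rwa [hr', hq', Submodule.starProjection_le_starProjection_iff] at this
  refine ⟨⟨K.starProjection, hmem, isStarProjection_starProjection⟩, ⟨?_, ?_⟩, hglb⟩
  · intro q hq
    obtain ⟨_, hq'⟩ := isStarProjection_iff_eq_starProjection_range.mp q.2.2
    change K.starProjection ≤ q.1
    rw [hq', Submodule.starProjection_le_starProjection_iff]
    exact iInf₂_le q hq
  · exact fun r hr => hglb r.1 r.2.2 fun q hq => hr hq

theorem exists_isGLB_proj (C : VonNeumannAlgebra H) (S : Set (Proj C)) : ∃ g, IsGLB S g :=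
  (exists_isGLB_proj' C S).imp fun _ h => h.1

theorem IsGLB.le_of_proj {C : VonNeumannAlgebra H} {S : Set (Proj C)} {g : Proj C}
    (hg : IsGLB S g) {r : H →L[ℂ] H} (hr : IsStarProjection r) (h : ∀ q ∈ S, r ≤ q.1) :
    r ≤ g.1 := by
  obtain ⟨g', hg', H'⟩ := exists_isGLB_proj' C S
  rw [hg.unique hg']
  exact H' r hr h

theorem exists_isLUB_proj' (C : VonNeumannAlgebra H) (S : Set (Proj C)) :
    ∃ g : Proj C, IsLUB S g ∧
      ∀ r : H →L[ℂ] H, IsStarProjection r → (∀ q ∈ S, q.1 ≤ r) → g.1 ≤ r := by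
  let c : Proj C → Proj C := fun q => ⟨1 - q.1, sub_mem (one_mem C) q.2.1, q.2.2.one_sub⟩
  obtain ⟨g, hg, hg'⟩ := exists_isGLB_proj' C (c '' S)
  have hlub : ∀ r : H →L[ℂ] H, IsStarProjection r → (∀ q ∈ S, q.1 ≤ r) → (c g).1 ≤ r := by
    intro r hr hrS
    refine sub_le_comm.mp (hg' (1 - r) hr.one_sub ?_)
    rintro _ ⟨q, hq, rfl⟩
    exact sub_le_sub_left (hrS q hq) 1
  refine ⟨c g, ⟨fun q hq => ?_, fun r hr => hlub r.1 r.2.2 fun q hq => hr hq⟩, hlub⟩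
  have : g.1 ≤ 1 - q.1 := hg.1 ⟨q, hq, rfl⟩
  exact le_sub_comm.mp this

theorem exists_isLUB_proj (C : VonNeumannAlgebra H) (S : Set (Proj C)) : ∃ g, IsLUB S g :=
  (exists_isLUB_proj' C S).imp fun _ h => h.1

theorem IsLUB.le_of_proj {C : VonNeumannAlgebra H} {S : Set (Proj C)} {g : Proj C}
    (hg : IsLUB S g) {r : H →L[ℂ] H} (hr : IsStarProjection r) (h : ∀ q ∈ S, q.1 ≤ r) :
    g.1 ≤ r := by
  obtain ⟨g', hg', H'⟩ := exists_isLUB_proj' C S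
  rw [hg.unique hg']
  exact H' r hr h

/-- Outer daseinisation `δᵒ(p)_C = ⋀ {q ∈ Proj C | q ≥ p}`. -/
noncomputable def outerDas (C : VonNeumannAlgebra H) (p : H →L[ℂ] H) : Proj C :=
  Classical.choose (exists_isGLB_proj C {q | p ≤ q.1})

theorem isGLB_outerDas (C : VonNeumannAlgebra H) (p : H →L[ℂ] H) :
    IsGLB {q : Proj C | p ≤ q.1} (outerDas C p) :=
  Classical.choose_spec (exists_isGLB_proj C {q | p ≤ q.1})

theorem outerDas_anti {D C : VonNeumannAlgebra H} (hDC : D ≤ C) (p : H →L[ℂ] H) :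
    (outerDas C p).1 ≤ (outerDas D p).1 :=
  (isGLB_outerDas D p).le_of_proj (outerDas C p).2.2 fun q hq =>
    (isGLB_outerDas C p).1 (show p ≤ (⟨q.1, hDC q.2.1, q.2.2⟩ : Proj C).1 from hq)

/-- Inner daseinisation `δⁱ(p)_C = ⋁ {q ∈ Proj C | q ≤ p}`. -/
noncomputable def innerDas (C : VonNeumannAlgebra H) (p : H →L[ℂ] H) : Proj C :=
  Classical.choose (exists_isLUB_proj C {q | q.1 ≤ p})

theorem isLUB_innerDas (C : VonNeumannAlgebra H) (p : H →L[ℂ] H) :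
    IsLUB {q : Proj C | q.1 ≤ p} (innerDas C p) :=
  Classical.choose_spec (exists_isLUB_proj C {q | q.1 ≤ p})

theorem innerDas_mono {D C : VonNeumannAlgebra H} (hDC : D ≤ C) (p : H →L[ℂ] H) :
    (innerDas D p).1 ≤ (innerDas C p).1 :=
  (isLUB_innerDas D p).le_of_proj (innerDas C p).2.2 fun q hq =>
    (isLUB_innerDas C p).1 (show (⟨q.1, hDC q.2.1, q.2.2⟩ : Proj C).1 ≤ p from hq)

/-- A state on `A`: a positive normalised linear functional. -/
structure State (A : VonNeumannAlgebra H) where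
  toLinearMap : A.toStarSubalgebra →ₗ[ℂ] ℂ
  nonneg : ∀ a, 0 ≤ toLinearMap (star a * a)
  map_one : toLinearMap 1 = 1

namespace State
variable {A : VonNeumannAlgebra H}

/-- The positive functional on `C(Σ_C, ℝ)` which corresponds to the restriction of `ψ` to `C`
under the Gelfand isomorphism `C ≅ C(Σ_C, ℂ)`. -/
noncomputable def localFunctional (ψ : State A) (C : Context A) : C_c(C.Spec, ℝ) →ₚ[ℝ] ℝ :=
  PositiveLinearMap.mk₀
    { toFun := fun f => (ψ.toLinearMap (C.ofSpec ((f : C(C.Spec, ℝ)).realToRCLike ℂ))).re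
      map_add' := fun f g => by
        have : ((f + g : C_c(C.Spec, ℝ)) : C(C.Spec, ℝ)).realToRCLike ℂ
            = (f : C(C.Spec, ℝ)).realToRCLike ℂ + (g : C(C.Spec, ℝ)).realToRCLike ℂ := by
          ext x; simp
        rw [this]; simp only [map_add, Complex.add_re]
      map_smul' := fun c f => by
        have : ((c • f : C_c(C.Spec, ℝ)) : C(C.Spec, ℝ)).realToRCLike ℂ
            = (c : ℂ) • (f : C(C.Spec, ℝ)).realToRCLike ℂ := by
          ext x; simp
        rw [this]; simp }
    (fun f hf => by
      let g : C(C.Spec, ℝ) := ⟨fun x => Real.sqrt (f x), by fun_prop⟩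
      have : (f : C(C.Spec, ℝ)).realToRCLike ℂ
          = star (g.realToRCLike ℂ) * g.realToRCLike ℂ := by
        ext x
        have h0 : (0 : ℝ) ≤ f x := hf x
        have h1 : Real.sqrt (f x) * Real.sqrt (f x) = f x := Real.mul_self_sqrt h0
        simp only [ContinuousMap.realToRCLike_apply, ContinuousMap.mul_apply,
          ContinuousMap.star_apply]
        change ((f x : ℝ) : ℂ) = star ((Real.sqrt (f x) : ℝ) : ℂ) * ((Real.sqrt (f x) : ℝ) : ℂ)
        rw [Complex.star_def, Complex.conj_ofReal, ← Complex.ofReal_mul, h1]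
      change 0 ≤ (ψ.toLinearMap (C.ofSpec ((f : C(C.Spec, ℝ)).realToRCLike ℂ))).re
      rw [this, map_mul, map_star]
      exact (Complex.le_def.mp (ψ.nonneg _)).1)

/-- The probability measure on `Σ_C` which represents the state `ψ|_C` (Riesz–Markov). -/
noncomputable def localMeasure (ψ : State A) (C : Context A) : Measure C.Spec :=
  RealRMK.rieszMeasure (ψ.localFunctional C)

instance (ψ : State A) (C : Context A) : (ψ.localMeasure C).Regular :=
  inferInstanceAs (RealRMK.rieszMeasure (ψ.localFunctional C)).Regular

instance (ψ : State A) (C : Context A) : IsFiniteMeasure (ψ.localMeasure C) :=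
  inferInstanceAs (IsFiniteMeasure (RealRMK.rieszMeasure (ψ.localFunctional C)))

theorem localMeasure_univ (ψ : State A) (C : Context A) :
    (ψ.localMeasure C).real Set.univ = 1 := by
  let o : C_c(C.Spec, ℝ) := ⟨1, HasCompactSupport.of_compactSpace 1⟩
  have h : ∫ x, o x ∂(ψ.localMeasure C) = ψ.localFunctional C o :=
    RealRMK.integral_rieszMeasure _ o
  have h1 : ((o : C(C.Spec, ℝ)).realToRCLike ℂ) = 1 := by
    ext x
    change ((1 : ℝ) : ℂ) = 1
    exact Complex.ofReal_one
  have h2 : ψ.localFunctional C o = 1 := by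
    change (ψ.toLinearMap (C.ofSpec ((o : C(C.Spec, ℝ)).realToRCLike ℂ))).re = 1
    rw [h1, _root_.map_one, ψ.map_one, Complex.one_re]
  rw [h2] at h
  change ∫ _, (1 : ℝ) ∂(ψ.localMeasure C) = 1 at h
  simpa using h

/-- The valuation `μ^C : 𝒪Σ_C → [0,1]` of the state `ψ|_C`. -/
noncomputable def localValuation (ψ : State A) (C : Context A)
    (U : Opens C.Spec) : unitInterval :=
  ⟨(ψ.localMeasure C).real U, measureReal_nonneg,
    (measureReal_mono (Set.subset_univ _)).trans (ψ.localMeasure_univ C).le⟩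

theorem map_localMeasure (ψ : State A) {D C : Context A} (hDC : D ≤ C) :
    (ψ.localMeasure C).map (Context.restr hDC) = ψ.localMeasure D := by
  have hc : Continuous (Context.restr hDC) := (Context.restr hDC).continuous
  have : ((ψ.localMeasure C).map (Context.restr hDC)).InnerRegular :=
    Measure.InnerRegular.map_of_continuous hc
  refine Measure.ext_of_integral_eq_on_compactlySupported fun f => ?_
  change ∫ x, (f : C(D.Spec, ℝ)) x ∂_ = _
  rw [integral_map hc.aemeasurable (f : C(D.Spec, ℝ)).continuous.aestronglyMeasurable]
  let g : C_c(C.Spec, ℝ) :=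
    ⟨(f : C(D.Spec, ℝ)).comp (Context.restr hDC), HasCompactSupport.of_compactSpace _⟩
  have hC : ∫ x, g x ∂(ψ.localMeasure C) = ψ.localFunctional C g :=
    RealRMK.integral_rieszMeasure _ g
  have hD : ∫ x, f x ∂(ψ.localMeasure D) = ψ.localFunctional D f :=
    RealRMK.integral_rieszMeasure _ f
  change ∫ x, g x ∂(ψ.localMeasure C) = _
  rw [hC, hD]
  change (ψ.toLinearMap (C.ofSpec ((g : C(C.Spec, ℝ)).realToRCLike ℂ))).re
    = (ψ.toLinearMap (D.ofSpec ((f : C(D.Spec, ℝ)).realToRCLike ℂ))).re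
  have key : (gelfandStarTransform C.alg).symm ((g : C(C.Spec, ℝ)).realToRCLike ℂ)
      = Context.incl hDC ((gelfandStarTransform D.alg).symm
        ((f : C(D.Spec, ℝ)).realToRCLike ℂ)) := by
    rw [StarAlgEquiv.symm_apply_eq]
    ext x
    have := congrArg (fun F : C(D.Spec, ℂ) => F (Context.restr hDC x))
      ((gelfandStarTransform D.alg).apply_symm_apply ((f : C(D.Spec, ℝ)).realToRCLike ℂ))
    exact this.symm
  have key' : C.ofSpec ((g : C(C.Spec, ℝ)).realToRCLike ℂ)
      = D.ofSpec ((f : C(D.Spec, ℝ)).realToRCLike ℂ) := congrArg C.inclA key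
  rw [key']

theorem localMeasure_restr (ψ : State A) {D C : Context A} (hDC : D ≤ C)
    (U : Opens D.Spec) :
    (ψ.localMeasure C).real (Context.restr hDC ⁻¹' U) = (ψ.localMeasure D).real U := by
  rw [← ψ.map_localMeasure hDC, measureReal_def, measureReal_def,
    Measure.map_apply (Context.restr hDC).continuous.measurable U.isOpen.measurableSet]

end State

end Contexts

section Automorphisms
variable {H : Type u} [NormedAddCommGroup H] [InnerProductSpace ℂ H] [CompleteSpace H]
variable {A : VonNeumannAlgebra H}

namespace Context

/-- The set `h[C]`, as a set of operators on `H`. -/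
def imageSet (h : A.toStarSubalgebra ≃⋆ₐ[ℂ] A.toStarSubalgebra) (C : Context A) :
    Set (H →L[ℂ] H) :=
  Set.range fun c : C.alg => (h (C.inclA c) : H →L[ℂ] H)

theorem star_imageSet (h : A.toStarSubalgebra ≃⋆ₐ[ℂ] A.toStarSubalgebra) (C : Context A) :
    C.imageSet h ∪ star (C.imageSet h) = C.imageSet h := by
  refine Set.union_eq_self_of_subset_right ?_
  rintro x ⟨c, hc⟩
  refine ⟨star c, ?_⟩
  have : h (C.inclA (star c)) = star (h (C.inclA c)) := by rw [map_star, map_star]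
  change (h (C.inclA (star c)) : H →L[ℂ] H) = x
  rw [this]
  exact star_eq_iff_star_eq.mp hc.symm

theorem comm_imageSet (h : A.toStarSubalgebra ≃⋆ₐ[ℂ] A.toStarSubalgebra) (C : Context A) :
    ∀ x ∈ C.imageSet h, ∀ y ∈ C.imageSet h, x * y = y * x := by
  rintro _ ⟨c, rfl⟩ _ ⟨d, rfl⟩
  have : h (C.inclA c) * h (C.inclA d) = h (C.inclA d) * h (C.inclA c) := by
    rw [← map_mul, ← map_mul, ← map_mul, ← map_mul, mul_comm c d]
  exact congrArg Subtype.val this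

/-- The order-preserving map `ĥ : 𝒞_A → 𝒞_A`, `C ↦ h[C]`, of a `*`-automorphism `h`. So that it is
visibly a von Neumann algebra, the context `ĥ(C)` is presented as the bicommutant of the set `h[C]`,
the smallest von Neumann algebra that contains it. -/
noncomputable def image (h : A.toStarSubalgebra ≃⋆ₐ[ℂ] A.toStarSubalgebra) :
    Context A →o Context A where
  toFun C :=
    { toVN :=
        { toStarSubalgebra := StarSubalgebra.centralizer ℂ
            (StarSubalgebra.centralizer ℂ (C.imageSet h) : Set (H →L[ℂ] H))
          centralizer_centralizer' := by
            change Set.centralizer (Set.centralizer ((StarSubalgebra.centralizer ℂ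
              (StarSubalgebra.centralizer ℂ (C.imageSet h) : Set (H →L[ℂ] H)) :
                StarSubalgebra ℂ (H →L[ℂ] H)) : Set (H →L[ℂ] H))) =
              ((StarSubalgebra.centralizer ℂ
              (StarSubalgebra.centralizer ℂ (C.imageSet h) : Set (H →L[ℂ] H)) :
                StarSubalgebra ℂ (H →L[ℂ] H)) : Set (H →L[ℂ] H))
            rw [StarSubalgebra.coe_centralizer_centralizer,
              Set.centralizer_centralizer_centralizer] }
      le := by
        intro x hx
        change x ∈ ((StarSubalgebra.centralizer ℂ
          (StarSubalgebra.centralizer ℂ (C.imageSet h) : Set (H →L[ℂ] H)) :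
            StarSubalgebra ℂ (H →L[ℂ] H)) : Set (H →L[ℂ] H)) at hx
        rw [StarSubalgebra.coe_centralizer_centralizer, star_imageSet] at hx
        have hsub : C.imageSet h ⊆ (A : Set (H →L[ℂ] H)) := by
          rintro _ ⟨c, rfl⟩
          exact (h (C.inclA c)).2
        have := Set.centralizer_subset (Set.centralizer_subset hsub) hx
        rwa [A.centralizer_centralizer] at this
      comm := by
        intro x hx y hy
        change x ∈ ((StarSubalgebra.centralizer ℂ
          (StarSubalgebra.centralizer ℂ (C.imageSet h) : Set (H →L[ℂ] H)) :
            StarSubalgebra ℂ (H →L[ℂ] H)) : Set (H →L[ℂ] H)) at hx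
        change y ∈ ((StarSubalgebra.centralizer ℂ
          (StarSubalgebra.centralizer ℂ (C.imageSet h) : Set (H →L[ℂ] H)) :
            StarSubalgebra ℂ (H →L[ℂ] H)) : Set (H →L[ℂ] H)) at hy
        rw [StarSubalgebra.coe_centralizer_centralizer, star_imageSet] at hx hy
        exact Set.centralizer_centralizer_comm_of_comm (C.comm_imageSet h) x hx y hy }
  monotone' := by
    intro D C hDC
    refine StarSubalgebra.centralizer_le (R := ℂ) _ _ ?_
    refine StarSubalgebra.centralizer_le (R := ℂ) _ _ ?_
    rintro _ ⟨c, rfl⟩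
    exact ⟨incl hDC c, rfl⟩

theorem coe_image (h : A.toStarSubalgebra ≃⋆ₐ[ℂ] A.toStarSubalgebra) (C : Context A) :
    ((image h C).toVN : Set (H →L[ℂ] H)) = (C.imageSet h).centralizer.centralizer := by
  change ((StarSubalgebra.centralizer ℂ
    (StarSubalgebra.centralizer ℂ (C.imageSet h) : Set (H →L[ℂ] H)) :
      StarSubalgebra ℂ (H →L[ℂ] H)) : Set (H →L[ℂ] H)) = _
  rw [StarSubalgebra.coe_centralizer_centralizer, star_imageSet]

/-- The restriction `h|_C : C → h[C]`. -/
noncomputable def toImage (h : A.toStarSubalgebra ≃⋆ₐ[ℂ] A.toStarSubalgebra) (C : Context A) :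
    C.alg →⋆ₐ[ℂ] (image h C).alg :=
  StarAlgHom.codRestrict ((A.toStarSubalgebra.subtype.comp (h : _ →⋆ₐ[ℂ] _)).comp C.inclA)
    (image h C).alg fun c => by
      change (h (C.inclA c) : H →L[ℂ] H) ∈ ((image h C).toVN : Set (H →L[ℂ] H))
      rw [coe_image]
      exact Set.subset_centralizer_centralizer ⟨c, rfl⟩

/-- The Gelfand dual `Σ(h|_C) : Σ_{h[C]} → Σ_C`, `λ ↦ λ ∘ h|_C`. -/
noncomputable def specMap (h : A.toStarSubalgebra ≃⋆ₐ[ℂ] A.toStarSubalgebra) (C : Context A) :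
    C((image h C).Spec, C.Spec) :=
  WeakDual.CharacterSpace.compContinuousMap (toImage h C)

theorem specMap_restr (h : A.toStarSubalgebra ≃⋆ₐ[ℂ] A.toStarSubalgebra) {D C : Context A}
    (hDC : D ≤ C) (x : (image h C).Spec) :
    specMap h D (restr ((image h).monotone hDC) x) = restr hDC (specMap h C x) :=
  rfl

/-- The subset `{λ ∈ Σ_C | λ(q) = 1}` of the Gelfand spectrum, for a projection `q` of `C`. -/
def specSet (C : Context A) (q : Proj C.toVN) : Set C.Spec := {x | x ⟨q.1, q.2.1⟩ = 1}

theorem spec_proj_eq (C : Context A) (q : Proj C.toVN) (x : C.Spec) :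
    x ⟨q.1, q.2.1⟩ = 0 ∨ x ⟨q.1, q.2.1⟩ = 1 := by
  have h1 : (⟨q.1, q.2.1⟩ : C.alg) * ⟨q.1, q.2.1⟩ = ⟨q.1, q.2.1⟩ :=
    Subtype.ext q.2.2.isIdempotentElem
  have h2 := congrArg x h1
  rw [map_mul] at h2
  have h3 : x ⟨q.1, q.2.1⟩ * (x ⟨q.1, q.2.1⟩ - 1) = 0 := by rw [mul_sub, h2]; ring
  rcases mul_eq_zero.mp h3 with h | h
  · exact Or.inl h
  · exact Or.inr (sub_eq_zero.mp h)

theorem isOpen_specSet (C : Context A) (q : Proj C.toVN) : IsOpen (C.specSet q) := by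
  have hc : Continuous fun x : C.Spec => x ⟨q.1, q.2.1⟩ :=
    (WeakDual.eval_continuous _).comp continuous_subtype_val
  have : C.specSet q = (fun x : C.Spec => x ⟨q.1, q.2.1⟩) ⁻¹' {0}ᶜ := by
    ext x
    rcases C.spec_proj_eq q x with h | h <;> simp [specSet, h]
  rw [this]
  exact isOpen_compl_singleton.preimage hc

theorem spec_proj_mono (C : Context A) (q r : Proj C.toVN) (hqr : q ≤ r) (x : C.Spec)
    (hx : x ⟨q.1, q.2.1⟩ = 1) : x ⟨r.1, r.2.1⟩ = 1 := by
  have h0 : q.1 * r.1 = q.1 := (q.2.2.le_iff_mul_eq_left r.2.2).mp hqr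
  have h1 : (⟨q.1, q.2.1⟩ : C.alg) * ⟨r.1, r.2.1⟩ = ⟨q.1, q.2.1⟩ := Subtype.ext h0
  have h2 := congrArg x h1
  rwa [map_mul, hx, one_mul] at h2

end Context




namespace Contravariant

/-- The terminal presheaf on `𝒞_A`. -/
abbrev one (A : VonNeumannAlgebra H) : (Context A)ᵒᵖ ⥤ Type u :=
  (Functor.const (Context A)ᵒᵖ).obj PUnit.{u + 1}

/-- The total space of the bundle over `𝒞_A` with fibre `Σ_{φ(C)}` over `C`. For `φ = id` this is
`Σ_↓`, and for `φ = ĥ` it is the pullback `ĥ^*Σ_↓`. -/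
def Bundle (φ : Context A →o Context A) : Type u := Σ C : Context A, (φ C).Spec

/-- `U` is open iff it is closed under restriction of functionals to smaller contexts and each
`U_C` is open in the Gelfand spectrum. -/
instance (φ : Context A →o Context A) : TopologicalSpace (Bundle φ) where
  IsOpen U := (∀ (D C : Context A) (hDC : D ≤ C) (x : (φ C).Spec),
      (⟨C, x⟩ : Bundle φ) ∈ U → (⟨D, Context.restr (φ.monotone hDC) x⟩ : Bundle φ) ∈ U) ∧
    ∀ C : Context A, IsOpen {x : (φ C).Spec | (⟨C, x⟩ : Bundle φ) ∈ U}
  isOpen_univ := ⟨fun _ _ _ _ _ => trivial, fun _ => isOpen_univ⟩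
  isOpen_inter := fun U V hU hV =>
    ⟨fun D C hDC x hx => ⟨hU.1 D C hDC x hx.1, hV.1 D C hDC x hx.2⟩,
      fun C => (hU.2 C).inter (hV.2 C)⟩
  isOpen_sUnion := fun S hS =>
    ⟨fun D C hDC x ⟨U, hU, hx⟩ => ⟨U, hU, (hS U hU).1 D C hDC x hx⟩, fun C => by
      have : {x : (φ C).Spec | (⟨C, x⟩ : Bundle φ) ∈ ⋃₀ S}
          = ⋃ U ∈ S, {x : (φ C).Spec | (⟨C, x⟩ : Bundle φ) ∈ U} := by
        ext x
        simp only [Set.mem_iUnion, exists_prop]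
        exact Iff.rfl
      rw [this]
      exact isOpen_biUnion fun U hU => (hS U hU).2 C⟩

/-- The part of the bundle over `↓C`, with the relative topology. -/
abbrev Stage (φ : Context A →o Context A) (C : Context A) : Type u := {x : Bundle φ // x.1 ≤ C}

/-- The fibre `U_D ⊆ Σ_{φ(D)}`, for `D ≤ C`, of an open set over `↓C`. -/
def fibre {φ : Context A →o Context A} {C : Context A} (U : Opens (Stage φ C)) (D : Context A)
    (hD : D ≤ C) : Opens (φ D).Spec :=
  ⟨{x | (⟨⟨D, x⟩, hD⟩ : Stage φ C) ∈ U}, by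
    obtain ⟨V, hV, hVU⟩ := isOpen_induced_iff.mp U.isOpen
    have := hV.2 D
    have h2 : {x : (φ D).Spec | (⟨⟨D, x⟩, hD⟩ : Stage φ C) ∈ U}
        = {x : (φ D).Spec | (⟨D, x⟩ : Bundle φ) ∈ V} := by
      ext x
      change (⟨⟨D, x⟩, hD⟩ : Stage φ C) ∈ (U : Set (Stage φ C)) ↔ _
      rw [← hVU]; rfl
    rw [h2]; exact this⟩

theorem fibre_restr {φ : Context A →o Context A} {C : Context A} (U : Opens (Stage φ C))
    (D E : Context A) (hED : E ≤ D) (hD : D ≤ C) (x : (φ D).Spec) (hx : x ∈ fibre U D hD) :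
    Context.restr (φ.monotone hED) x ∈ fibre U E (hED.trans hD) := by
  obtain ⟨V, hV, hVU⟩ := isOpen_induced_iff.mp U.isOpen
  change (⟨⟨D, x⟩, hD⟩ : Stage φ C) ∈ (U : Set (Stage φ C)) at hx
  change (⟨⟨E, _⟩, hED.trans hD⟩ : Stage φ C) ∈ (U : Set (Stage φ C))
  rw [← hVU] at hx ⊢
  exact hV.1 E D hED x hx

/-- The inclusion of the part over `↓D` in the part over `↓C`, for `D ≤ C`. -/
def stageIncl (φ : Context A →o Context A) {D C : Context A} (hDC : D ≤ C) :
    C(Stage φ D, Stage φ C) :=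
  ⟨fun x => ⟨x.1, x.2.trans hDC⟩, continuous_subtype_val.subtype_mk _⟩

/-- The internal topology as a presheaf: its sections over `C` are the open sets over `↓C`. For
`φ = id` this is `𝒪Σ`, and for `φ = ĥ` it is `𝒪H^*Σ`. -/
def opens (φ : Context A →o Context A) : (Context A)ᵒᵖ ⥤ Type u where
  obj C := Opens (Stage φ C.unop)
  map f := TypeCat.ofHom fun U => Opens.comap (stageIncl φ (leOfHom f.unop)) U
  map_id _ := rfl
  map_comp _ _ := rfl

/-- The open set of the total space `U` as a global element `1 ⟶ 𝒪` of the internal topology. -/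
def globalOpen {φ : Context A →o Context A} (U : Opens (Bundle φ)) : one A ⟶ opens φ where
  app C := TypeCat.ofHom fun _ =>
    (Opens.comap ⟨Subtype.val, continuous_subtype_val⟩ U : Opens (Stage φ C.unop))
  naturality _ _ _ := rfl

/-- The presheaf `[0,1]_l` of lower reals between `0` and `1`: its sections over `C` are the
order-reversing functions `↓C → [0,1]`. -/
def lowerUnit (A : VonNeumannAlgebra H) : (Context A)ᵒᵖ ⥤ Type u where
  obj C := {s : Set.Iic C.unop → unitInterval // Antitone s}
  map f := TypeCat.ofHom fun s =>
    ⟨fun D => s.1 ⟨D.1, D.2.trans (leOfHom f.unop)⟩, fun _ _ hDE => s.2 hDE⟩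
  map_id _ := rfl
  map_comp _ _ := rfl

/-- The constant lower real `1`. -/
def lowerOne (A : VonNeumannAlgebra H) : one A ⟶ lowerUnit A where
  app C := TypeCat.ofHom fun _ =>
    (⟨fun _ => 1, fun _ _ _ => le_rfl⟩ : {s : Set.Iic C.unop → unitInterval // Antitone s})
  naturality _ _ _ := rfl

/-- The internal valuation of a state: `U ↦ (D ↦ μ^{φ(D)}(U_D))`. For `φ = id` this is the
valuation `μ : 𝒪Σ ⟶ [0,1]_l`, and for `φ = ĥ` it is `μ_h : 𝒪H^*Σ ⟶ [0,1]_l`. -/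
noncomputable def valuation (ψ : State A) (φ : Context A →o Context A) :
    opens φ ⟶ lowerUnit A where
  app C := TypeCat.ofHom fun U : Opens (Stage φ C.unop) =>
    (⟨fun D => ψ.localValuation (φ D.1) (fibre U D.1 D.2), fun E D hED => by
      change (ψ.localMeasure (φ D.1)).real _ ≤ (ψ.localMeasure (φ E.1)).real _
      rw [← ψ.localMeasure_restr (φ.monotone hED)]
      exact measureReal_mono fun x hx => fibre_restr U D.1 E.1 hED D.2 x hx⟩ :
      {s : Set.Iic C.unop → unitInterval // Antitone s})
  naturality _ _ _ := rfl

/-- The continuous map `Σ(h) : ĥ^*Σ_↓ → Σ_↓`, `(C, λ) ↦ (C, λ ∘ h|_C)`. -/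
noncomputable def specMap (h : A.toStarSubalgebra ≃⋆ₐ[ℂ] A.toStarSubalgebra) :
    C(Bundle (Context.image h), Bundle (OrderHom.id : Context A →o Context A)) where
  toFun x := ⟨x.1, Context.specMap h x.1 x.2⟩
  continuous_toFun := ⟨fun _ hU =>
    ⟨fun D C hDC x hx => hU.1 D C hDC (Context.specMap h C x) hx,
      fun C => (hU.2 C).preimage (Context.specMap h C).continuous⟩⟩

/-- The restriction of `Σ(h)` to the parts over `↓C`. -/
noncomputable def stageSpecMap (h : A.toStarSubalgebra ≃⋆ₐ[ℂ] A.toStarSubalgebra)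
    (C : Context A) :
    C(Stage (Context.image h) C, Stage (OrderHom.id : Context A →o Context A) C) :=
  ⟨fun x => ⟨specMap h x.1, x.2⟩,
    ((specMap h).continuous.comp continuous_subtype_val).subtype_mk _⟩

/-- The internal inverse image map `Σ(h)⁻¹ : 𝒪Σ ⟶ 𝒪H^*Σ`. -/
noncomputable def invImage (h : A.toStarSubalgebra ≃⋆ₐ[ℂ] A.toStarSubalgebra) :
    opens (OrderHom.id : Context A →o Context A) ⟶ opens (Context.image h) where
  app C := TypeCat.ofHom fun U => Opens.comap (stageSpecMap h C.unop) U
  naturality _ _ _ := rfl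

/-- The elementary proposition
`[a ∈ Δ] = {(C, λ) | λ(δᵒ(χ_Δ(a))_C) = 1}` as an open subset of `Σ_↓`. -/
noncomputable def elementaryOpen (a : A.toStarSubalgebra) (Δ : Set ℝ) :
    Opens (Bundle (OrderHom.id : Context A →o Context A)) :=
  ⟨{x | x.2 ∈ x.1.specSet (outerDas x.1.toVN (spectralProjection (a : H →L[ℂ] H) Δ))}, by
    let p := spectralProjection (a : H →L[ℂ] H) Δ
    refine ⟨fun D C hDC x hx => ?_, fun C => C.isOpen_specSet (outerDas C.toVN p)⟩
    exact C.spec_proj_mono (outerDas C.toVN p)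
      ⟨(outerDas D.toVN p).1, hDC (outerDas D.toVN p).2.1, (outerDas D.toVN p).2.2⟩
      (outerDas_anti hDC p) x hx⟩

/-- The elementary proposition `[a ∈ Δ] : 1 ⟶ 𝒪Σ`. -/
noncomputable def elementary (a : A.toStarSubalgebra) (Δ : Set ℝ) :
    one A ⟶ opens (OrderHom.id : Context A →o Context A) :=
  globalOpen (elementaryOpen a Δ)

/-- Presheaf semantics of an equality of closed terms: `C ⊩ s = t`. -/
def Forces {X : (Context A)ᵒᵖ ⥤ Type u} (C : Context A) (s t : one A ⟶ X) : Prop :=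
  s.app (op C) PUnit.unit = t.app (op C) PUnit.unit

/-- The truth value of `s = t`: the sieve on `𝒞_A` of the contexts that force it. -/
def truthValue {X : (Context A)ᵒᵖ ⥤ Type u} (s t : one A ⟶ X) : LowerSet (Context A) where
  carrier := {C | Forces C s t}
  lower' := by
    intro C D hDC hC
    have hs := ConcreteCategory.congr_hom (s.naturality (homOfLE hDC).op) PUnit.unit
    have ht := ConcreteCategory.congr_hom (t.naturality (homOfLE hDC).op) PUnit.unit
    have : X.map (homOfLE hDC).op (s.app (op C) PUnit.unit)
        = X.map (homOfLE hDC).op (t.app (op C) PUnit.unit) := congrArg _ hC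
    exact hs.trans (this.trans ht.symm)

end Contravariant

namespace Covariant

/-- The terminal copresheaf on `𝒞_A`. -/
abbrev one (A : VonNeumannAlgebra H) : Context A ⥤ Type u :=
  (Functor.const (Context A)).obj PUnit.{u + 1}

/-- The total space of the bundle over `𝒞_A` with fibre `Σ_{φ(C)}` over `C`. For `φ = id` this is
`Σ_↑`, and for `φ = ĥ` it is the pullback `ĥ^*Σ_↑`. -/
def Bundle (φ : Context A →o Context A) : Type u := Σ C : Context A, (φ C).Spec

/-- `U` is open iff it is closed under extension of functionals to larger contexts and each
`U_C` is open in the Gelfand spectrum. -/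
instance (φ : Context A →o Context A) : TopologicalSpace (Bundle φ) where
  IsOpen U := (∀ (D C : Context A) (hDC : D ≤ C) (x : (φ C).Spec),
      (⟨D, Context.restr (φ.monotone hDC) x⟩ : Bundle φ) ∈ U → (⟨C, x⟩ : Bundle φ) ∈ U) ∧
    ∀ C : Context A, IsOpen {x : (φ C).Spec | (⟨C, x⟩ : Bundle φ) ∈ U}
  isOpen_univ := ⟨fun _ _ _ _ _ => trivial, fun _ => isOpen_univ⟩
  isOpen_inter := fun U V hU hV =>
    ⟨fun D C hDC x hx => ⟨hU.1 D C hDC x hx.1, hV.1 D C hDC x hx.2⟩,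
      fun C => (hU.2 C).inter (hV.2 C)⟩
  isOpen_sUnion := fun S hS =>
    ⟨fun D C hDC x ⟨U, hU, hx⟩ => ⟨U, hU, (hS U hU).1 D C hDC x hx⟩, fun C => by
      have : {x : (φ C).Spec | (⟨C, x⟩ : Bundle φ) ∈ ⋃₀ S}
          = ⋃ U ∈ S, {x : (φ C).Spec | (⟨C, x⟩ : Bundle φ) ∈ U} := by
        ext x
        simp only [Set.mem_iUnion, exists_prop]
        exact Iff.rfl
      rw [this]
      exact isOpen_biUnion fun U hU => (hS U hU).2 C⟩

/-- The part of the bundle over `↑C`, with the relative topology. -/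
abbrev Stage (φ : Context A →o Context A) (C : Context A) : Type u := {x : Bundle φ // C ≤ x.1}

/-- The fibre `U_D ⊆ Σ_{φ(D)}`, for `C ≤ D`, of an open set over `↑C`. -/
def fibre {φ : Context A →o Context A} {C : Context A} (U : Opens (Stage φ C)) (D : Context A)
    (hD : C ≤ D) : Opens (φ D).Spec :=
  ⟨{x | (⟨⟨D, x⟩, hD⟩ : Stage φ C) ∈ U}, by
    obtain ⟨V, hV, hVU⟩ := isOpen_induced_iff.mp U.isOpen
    have := hV.2 D
    have h2 : {x : (φ D).Spec | (⟨⟨D, x⟩, hD⟩ : Stage φ C) ∈ U}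
        = {x : (φ D).Spec | (⟨D, x⟩ : Bundle φ) ∈ V} := by
      ext x
      change (⟨⟨D, x⟩, hD⟩ : Stage φ C) ∈ (U : Set (Stage φ C)) ↔ _
      rw [← hVU]; rfl
    rw [h2]; exact this⟩

theorem fibre_restr {φ : Context A →o Context A} {C : Context A} (U : Opens (Stage φ C))
    (D E : Context A) (hDE : D ≤ E) (hD : C ≤ D) (x : (φ E).Spec)
    (hx : Context.restr (φ.monotone hDE) x ∈ fibre U D hD) : x ∈ fibre U E (hD.trans hDE) := by
  obtain ⟨V, hV, hVU⟩ := isOpen_induced_iff.mp U.isOpen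
  change (⟨⟨D, _⟩, hD⟩ : Stage φ C) ∈ (U : Set (Stage φ C)) at hx
  change (⟨⟨E, x⟩, hD.trans hDE⟩ : Stage φ C) ∈ (U : Set (Stage φ C))
  rw [← hVU] at hx ⊢
  exact hV.1 D E hDE x hx

/-- The inclusion of the part over `↑D` in the part over `↑C`, for `C ≤ D`. -/
def stageIncl (φ : Context A →o Context A) {C D : Context A} (hCD : C ≤ D) :
    C(Stage φ D, Stage φ C) :=
  ⟨fun x => ⟨x.1, hCD.trans x.2⟩, continuous_subtype_val.subtype_mk _⟩

/-- The frame of the internal locale as a copresheaf: its sections over `C` are the open sets over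
`↑C`. For `φ = id` this is `𝒪Σ`, and for `φ = ĥ` it is `𝒪H^♯Σ`. -/
def opens (φ : Context A →o Context A) : Context A ⥤ Type u where
  obj C := Opens (Stage φ C)
  map f := TypeCat.ofHom fun U => Opens.comap (stageIncl φ (leOfHom f)) U
  map_id _ := rfl
  map_comp _ _ := rfl

/-- The open set of the total space `U` as a global element `1 ⟶ 𝒪` of the internal frame. -/
def globalOpen {φ : Context A →o Context A} (U : Opens (Bundle φ)) : one A ⟶ opens φ where
  app C := TypeCat.ofHom fun _ =>
    (Opens.comap ⟨Subtype.val, continuous_subtype_val⟩ U : Opens (Stage φ C))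
  naturality _ _ _ := rfl

/-- The copresheaf `[0,1]_l` of lower reals between `0` and `1`: its sections over `C` are the
order-preserving functions `↑C → [0,1]`. -/
def lowerUnit (A : VonNeumannAlgebra H) : Context A ⥤ Type u where
  obj C := {s : Set.Ici C → unitInterval // Monotone s}
  map f := TypeCat.ofHom fun s =>
    ⟨fun D => s.1 ⟨D.1, (leOfHom f).trans D.2⟩, fun _ _ hDE => s.2 hDE⟩
  map_id _ := rfl
  map_comp _ _ := rfl

/-- The constant lower real `1`. -/
def lowerOne (A : VonNeumannAlgebra H) : one A ⟶ lowerUnit A where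
  app C := TypeCat.ofHom fun _ =>
    (⟨fun _ => 1, fun _ _ _ => le_rfl⟩ : {s : Set.Ici C → unitInterval // Monotone s})
  naturality _ _ _ := rfl

/-- The internal valuation of a state: `U ↦ (D ↦ μ^{φ(D)}(U_D))`. For `φ = id` this is the
valuation `μ : 𝒪Σ ⟶ [0,1]_l`, and for `φ = ĥ` it is `μ_h : 𝒪H^♯Σ ⟶ [0,1]_l`. -/
noncomputable def valuation (ψ : State A) (φ : Context A →o Context A) :
    opens φ ⟶ lowerUnit A where
  app C := TypeCat.ofHom fun U : Opens (Stage φ C) =>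
    (⟨fun D => ψ.localValuation (φ D.1) (fibre U D.1 D.2), fun D E hDE => by
      change (ψ.localMeasure (φ D.1)).real _ ≤ (ψ.localMeasure (φ E.1)).real _
      rw [← ψ.localMeasure_restr (φ.monotone hDE)]
      exact measureReal_mono fun x hx => fibre_restr U D.1 E.1 hDE D.2 x hx⟩ :
      {s : Set.Ici C → unitInterval // Monotone s})
  naturality _ _ _ := rfl

/-- The continuous map `Σ(h) : ĥ^*Σ_↑ → Σ_↑`, `(C, λ) ↦ (C, λ ∘ h|_C)`. -/
noncomputable def specMap (h : A.toStarSubalgebra ≃⋆ₐ[ℂ] A.toStarSubalgebra) :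
    C(Bundle (Context.image h), Bundle (OrderHom.id : Context A →o Context A)) where
  toFun x := ⟨x.1, Context.specMap h x.1 x.2⟩
  continuous_toFun := ⟨fun _ hU =>
    ⟨fun D C hDC x hx => hU.1 D C hDC (Context.specMap h C x) hx,
      fun C => (hU.2 C).preimage (Context.specMap h C).continuous⟩⟩

/-- The restriction of `Σ(h)` to the parts over `↑C`. -/
noncomputable def stageSpecMap (h : A.toStarSubalgebra ≃⋆ₐ[ℂ] A.toStarSubalgebra)
    (C : Context A) :
    C(Stage (Context.image h) C, Stage (OrderHom.id : Context A →o Context A) C) :=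
  ⟨fun x => ⟨specMap h x.1, x.2⟩,
    ((specMap h).continuous.comp continuous_subtype_val).subtype_mk _⟩

/-- The internal frame homomorphism `Σ(h)⁻¹ : 𝒪Σ ⟶ 𝒪H^♯Σ`. -/
noncomputable def invImage (h : A.toStarSubalgebra ≃⋆ₐ[ℂ] A.toStarSubalgebra) :
    opens (OrderHom.id : Context A →o Context A) ⟶ opens (Context.image h) where
  app C := TypeCat.ofHom fun U => Opens.comap (stageSpecMap h C) U
  naturality _ _ _ := rfl

/-- The elementary proposition
`[a ∈ Δ] = {(C, λ) | λ(δⁱ(χ_Δ(a))_C) = 1}` as an open subset of `Σ_↑`. -/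
noncomputable def elementaryOpen (a : A.toStarSubalgebra) (Δ : Set ℝ) :
    Opens (Bundle (OrderHom.id : Context A →o Context A)) :=
  ⟨{x | x.2 ∈ x.1.specSet (innerDas x.1.toVN (spectralProjection (a : H →L[ℂ] H) Δ))}, by
    let p := spectralProjection (a : H →L[ℂ] H) Δ
    refine ⟨fun D C hDC x hx => ?_, fun C => C.isOpen_specSet (innerDas C.toVN p)⟩
    exact C.spec_proj_mono
      ⟨(innerDas D.toVN p).1, hDC (innerDas D.toVN p).2.1, (innerDas D.toVN p).2.2⟩
      (innerDas C.toVN p) (innerDas_mono hDC p) x hx⟩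

/-- The elementary proposition `[a ∈ Δ] : 1 ⟶ 𝒪Σ`. -/
noncomputable def elementary (a : A.toStarSubalgebra) (Δ : Set ℝ) :
    one A ⟶ opens (OrderHom.id : Context A →o Context A) :=
  globalOpen (elementaryOpen a Δ)

/-- Semantics of an equality of closed terms in the copresheaf topos: `C ⊩ s = t`. -/
def Forces {X : Context A ⥤ Type u} (C : Context A) (s t : one A ⟶ X) : Prop :=
  s.app C PUnit.unit = t.app C PUnit.unit

/-- The truth value of `s = t`: the cosieve on `𝒞_A` of the contexts that force it. -/
def truthValue {X : Context A ⥤ Type u} (s t : one A ⟶ X) : UpperSet (Context A) where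
  carrier := {C | Forces C s t}
  upper' := by
    intro C D hCD hC
    have hs := ConcreteCategory.congr_hom (s.naturality (homOfLE hCD)) PUnit.unit
    have ht := ConcreteCategory.congr_hom (t.naturality (homOfLE hCD)) PUnit.unit
    have : X.map (homOfLE hCD) (s.app C PUnit.unit)
        = X.map (homOfLE hCD) (t.app C PUnit.unit) := congrArg _ hC
    exact hs.trans (this.trans ht.symm)

end Covariant

end Automorphisms

/-!
The uncountable joins and meets in the daseinisations are order-theoretic, so everything rests on
`h` being an isomorphism of projection lattices that matches the contexts `C` with the contexts
`h[C]` and the spectral projections of `a` with those of `h a`.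

That `h[C]` is a von Neumann algebra is not formal, since `h` is not given by a unitary operator.
It is a commutative C*-algebra in which every set of projections has a supremum, and suprema of
projections in `A` are preserved by `h`. By a cyclic-vector argument every projection of the
bicommutant is the supremum of the projections of `h[C]` below it, hence lies in `h[C]`; and a von
Neumann algebra is the norm closure of the linear span of its projections.

The spectral projection of a bounded open set `{f ≠ 0}` is the support projection of `f(a)`, a
notion which `h` preserves because it is expressed in the projection lattice of `A`. The other
Borel sets follow by complements and countable unions.
-/

theorem isStarProjection_map_iff {R S F : Type*} [Mul R] [Star R] [Mul S] [Star S]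
    [FunLike F R S] [MulHomClass F R S] [StarHomClass F R S] (f : F)
    (hf : Function.Injective f) {p : R} : IsStarProjection (f p) ↔ IsStarProjection p := by
  simp only [isStarProjection_iff, IsIdempotentElem, IsSelfAdjoint, ← map_mul, ← map_star,
    hf.eq_iff]

section Density

theorem subset_closure_of_forall_exists_norm_sub_le {G σ : Type*} [SeminormedAddCommGroup G]
    [SetLike σ G] [AddSubgroupClass σ G] {P : Set G} {S : σ}
    (h : ∀ a ∈ P, ∃ s ∈ S, a - s ∈ P ∧ ‖a - s‖ ≤ ‖a‖ / 2) :
    P ⊆ closure S := by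
  have approx (k : ℕ) : ∀ a ∈ P, ∃ s ∈ S, ‖a - s‖ ≤ (1 / 2) ^ k * ‖a‖ := by
    induction k with
    | zero => exact fun a _ => ⟨0, zero_mem S, by simp⟩
    | succ k ih =>
      intro a ha
      obtain ⟨s, hs, has, hle⟩ := h a ha
      obtain ⟨t, ht, hle'⟩ := ih _ has
      refine ⟨s + t, add_mem hs ht, ?_⟩
      calc ‖a - (s + t)‖ ≤ (1 / 2) ^ k * ‖a - s‖ := by rwa [← sub_sub]
        _ ≤ (1 / 2) ^ k * (‖a‖ / 2) := by gcongr
        _ = (1 / 2) ^ (k + 1) * ‖a‖ := by ring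
  intro a ha
  refine Metric.mem_closure_iff.mpr fun ε hε => ?_
  have hlim : Filter.Tendsto (fun k : ℕ => (1 / 2 : ℝ) ^ k * ‖a‖) Filter.atTop (nhds 0) := by
    simpa using (tendsto_pow_atTop_nhds_zero_of_lt_one (by norm_num)
      (by norm_num : (1 / 2 : ℝ) < 1)).mul_const ‖a‖
  obtain ⟨k, hk⟩ := (hlim.eventually_lt_const hε).exists
  obtain ⟨s, hs, hle⟩ := approx k a ha
  exact ⟨s, hs, by rw [dist_eq_norm]; exact hle.trans_lt hk⟩

/-- A `*`-subalgebra has sign projections if for every self-adjoint element `a` it contains a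
projection which separates the positive part `u⋆u` of some decomposition `a = u⋆u - v⋆v` from the
negative part `v⋆v`. The squares are spelled out because the notion then passes along injective
`*`-homomorphisms, without comparing the orders of the two algebras. -/
def HasSignProjections {E : Type*} [Ring E] [StarRing E] [Algebra ℂ E] [StarModule ℂ E]
    (B : StarSubalgebra ℂ E) : Prop :=
  ∀ a ∈ B, IsSelfAdjoint a → ∃ e ∈ B, IsStarProjection e ∧
    ∃ u ∈ B, ∃ v ∈ B, a = star u * u - star v * v ∧ u * e = u ∧ v * e = 0

namespace HasSignProjections

theorem range {C E : Type*} [Ring C] [StarRing C] [Algebra ℂ C]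
    [StarModule ℂ C] [Ring E] [StarRing E] [Algebra ℂ E] [StarModule ℂ E]
    {B : StarSubalgebra ℂ C} (hB : HasSignProjections B) (f : B →⋆ₐ[ℂ] E)
    (hf : Function.Injective f) : HasSignProjections f.range := by
  rintro _ ⟨c, rfl⟩ hc
  have hc' : IsSelfAdjoint c := hf ((map_star f c).trans hc)
  obtain ⟨e, heB, he, u, huB, v, hvB, huv, hue, hve⟩ :=
    hB c c.2 (hc'.map B.subtype)
  have he' : IsStarProjection (⟨e, heB⟩ : B) :=
    (isStarProjection_map_iff B.subtype Subtype.val_injective).mp he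
  refine ⟨f ⟨e, heB⟩, ⟨_, rfl⟩, he'.map f, f ⟨u, huB⟩, ⟨_, rfl⟩, f ⟨v, hvB⟩, ⟨_, rfl⟩, ?_, ?_, ?_⟩
  · have h : c = star ⟨u, huB⟩ * ⟨u, huB⟩ - star ⟨v, hvB⟩ * ⟨v, hvB⟩ := Subtype.ext huv
    rw [← map_star, ← map_star, ← map_mul, ← map_mul, ← map_sub]
    exact congrArg f h
  · rw [← map_mul]
    exact congrArg f (Subtype.ext hue)
  · rw [← map_mul, ← map_zero f]
    exact congrArg f (Subtype.ext hve)

end HasSignProjections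

section CStarAlgebra
variable {E : Type*} [CStarAlgebra E] [PartialOrder E] [StarOrderedRing E]

theorem norm_le_of_neg_smul_one_le_of_le_smul_one {a : E} {r : ℝ}
    (hr : 0 ≤ r) (hle : -(r • 1) ≤ a) (hge : a ≤ r • 1) : ‖a‖ ≤ r := by
  have ha : IsSelfAdjoint a :=
    .of_ge hle ((IsSelfAdjoint.all r).smul (.one E)).neg
  rw [← Algebra.algebraMap_eq_smul_one] at hle hge
  rw [← map_neg, algebraMap_le_iff_le_spectrum] at hle
  rw [le_algebraMap_iff_spectrum_le] at hge
  rw [← cfc_id ℝ a, norm_cfc_le_iff _ a hr]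
  exact fun t ht => abs_le.mpr ⟨hle t ht, hge t ht⟩

theorem le_norm_smul_projection {a u v e : E} (ha : IsSelfAdjoint a) (he : IsStarProjection e)
    (huv : a = star u * u - star v * v) (hue : u * e = u) (hve : v * e = 0) : a ≤ ‖a‖ • e := by
  have heu : star e * star u = star u := by rw [← star_mul, hue]
  have hev : star e * star v = 0 := by rw [← star_mul, hve, star_zero]
  calc a ≤ star u * u := huv ▸ sub_le_self _ (star_mul_self_nonneg v)
    _ = star e * a * e := by
      rw [huv, mul_sub, ← mul_assoc, ← mul_assoc, heu, hev, zero_mul, sub_zero, mul_assoc, hue]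
    _ ≤ ‖a‖ • (star e * e) := CStarAlgebra.star_left_conjugate_le_norm_smul
    _ = ‖a‖ • e := by rw [he.isSelfAdjoint.star_eq, he.isIdempotentElem]

variable {M B : StarSubalgebra ℂ E}

namespace HasSignProjections

/- The bounds `-‖a‖ (1 - e) ≤ a ≤ ‖a‖ e` put `a - ‖a‖ (e - 1/2)` between `∓ ‖a‖ / 2`. -/
theorem exists_norm_sub_smul_le (hM : HasSignProjections M) {a : E} (ha : a ∈ M)
    (hsa : IsSelfAdjoint a) :
    ∃ e ∈ M, IsStarProjection e ∧ ‖a - ‖a‖ • (e - (1 / 2 : ℝ) • 1)‖ ≤ ‖a‖ / 2 := by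
  obtain ⟨e, heM, he, u, -, v, -, huv, hue, hve⟩ := hM a ha hsa
  have hle : a ≤ ‖a‖ • e := le_norm_smul_projection hsa he huv hue hve
  have hge : -a ≤ ‖a‖ • (1 - e) := by
    have := le_norm_smul_projection hsa.neg he.one_sub (u := v) (v := u) (by rw [huv, neg_sub])
      (by rw [mul_sub, hve, mul_one, sub_zero]) (by rw [mul_sub, hue, mul_one, sub_self])
    rwa [norm_neg] at this
  refine ⟨e, heM, he, norm_le_of_neg_smul_one_le_of_le_smul_one (by positivity) ?_ ?_⟩
  · rw [neg_le, ← sub_nonneg]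
    convert sub_nonneg.mpr hge using 1
    module
  · rw [← sub_nonneg]
    convert sub_nonneg.mpr hle using 1
    module

theorem le_of_forall_isStarProjection_mem (hM : HasSignProjections M)
    (hB : IsClosed (B : Set E)) (h : ∀ p ∈ M, IsStarProjection p → p ∈ B) : M ≤ B := by
  have smul_mem {S : StarSubalgebra ℂ E} (r : ℝ) {x : E} (hx : x ∈ S) : r • x ∈ S :=
    S.smul_mem hx (r : ℂ)
  have selfAdjoint_mem : ∀ a ∈ {a | a ∈ M ∧ IsSelfAdjoint a}, a ∈ B := by
    refine fun a ha => hB.closure_subset (subset_closure_of_forall_exists_norm_sub_le ?_ ha)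
    rintro a ⟨ha, hsa⟩
    obtain ⟨e, heM, he, hle⟩ := hM.exists_norm_sub_smul_le ha hsa
    have mem {S : StarSubalgebra ℂ E} (heS : e ∈ S) : ‖a‖ • (e - (1 / 2 : ℝ) • 1) ∈ S :=
      smul_mem _ (sub_mem heS (smul_mem _ S.one_mem))
    have hsa' : IsSelfAdjoint (‖a‖ • (e - (1 / 2 : ℝ) • 1)) :=
      (IsSelfAdjoint.all _).smul (he.isSelfAdjoint.sub ((IsSelfAdjoint.all _).smul (.one E)))
    exact ⟨_, mem (h e heM he), ⟨sub_mem ha (mem heM), hsa.sub hsa'⟩, hle⟩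
  intro a ha
  rw [← realPart_add_I_smul_imaginaryPart a]
  refine add_mem (selfAdjoint_mem _ ⟨?_, (realPart a).2⟩)
    (B.smul_mem (selfAdjoint_mem _ ⟨?_, (imaginaryPart a).2⟩) _)
  · rw [realPart_apply_coe]
    exact smul_mem _ (add_mem ha (star_mem ha))
  · rw [imaginaryPart_apply_coe]
    exact M.smul_mem (smul_mem _ (sub_mem ha (star_mem ha))) _

end HasSignProjections
end CStarAlgebra
end Density

section Projections
variable {H : Type u} [NormedAddCommGroup H] [InnerProductSpace ℂ H] [CompleteSpace H]

theorem projection_apply_apply {p : H →L[ℂ] H} (hp : IsStarProjection p) (x : H) :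
    p (p x) = p x :=
  DFunLike.congr_fun hp.isIdempotentElem x

theorem norm_projection_apply_le {p : H →L[ℂ] H} (hp : IsStarProjection p) (x : H) :
    ‖p x‖ ≤ ‖x‖ :=
  p.le_of_opNorm_le_of_le hp.norm_le le_rfl |>.trans_eq (one_mul _)

theorem mul_projection_eq_self_iff {e : H →L[ℂ] H} (he : IsStarProjection e) (b : H →L[ℂ] H) :
    b * e = b ↔ ∀ x, e x = 0 → b x = 0 := by
  constructor
  · intro h x hx
    rw [← h, mul_apply_eq_comp, hx, map_zero]
  · intro h
    ext x
    have hker : e (x - e x) = 0 := by rw [map_sub, projection_apply_apply he, sub_self]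
    have := h _ hker
    rw [map_sub, sub_eq_zero] at this
    exact this.symm

theorem projection_le_iff {p q : H →L[ℂ] H} (hp : IsStarProjection p) (hq : IsStarProjection q) :
    p ≤ q ↔ ∀ x, q x = 0 → p x = 0 :=
  (hp.le_iff_mul_eq_left hq).trans (mul_projection_eq_self_iff hq p)

/-- The projection `e` is the support of the operator `b`, that is, the projection onto the
orthogonal complement of the kernel of `b`. -/
structure IsSupportProjection (e b : H →L[ℂ] H) : Prop where
  isStarProjection : IsStarProjection e
  apply_eq_zero_iff (x : H) : e x = 0 ↔ b x = 0

theorem IsSupportProjection.le_iff {e b q : H →L[ℂ] H} (he : IsSupportProjection e b)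
    (hq : IsStarProjection q) : e ≤ q ↔ b * q = b := by
  simp_rw [projection_le_iff he.isStarProjection hq, mul_projection_eq_self_iff hq,
    he.apply_eq_zero_iff]

theorem exists_isSupportProjection (M : VonNeumannAlgebra H) {b : H →L[ℂ] H} (hb : b ∈ M) :
    ∃ e ∈ M, IsSupportProjection e b := by
  have : CompleteSpace b.ker := b.isClosed_ker.completeSpace_coe
  have hmem : b.ker.starProjection ∈ M := by
    rw [VonNeumannAlgebra.IsStarProjection.mem_iff isStarProjection_starProjection]
    intro y hy
    rw [Submodule.range_starProjection]
    intro x (hx : b x = 0)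
    have hcomm : b (y x) = y (b x) :=
      DFunLike.congr_fun (VonNeumannAlgebra.mem_commutant_iff.mp hy b hb) x
    exact hcomm.trans (by rw [hx, map_zero])
  refine ⟨1 - b.ker.starProjection, sub_mem (one_mem M) hmem,
    isStarProjection_starProjection.one_sub, fun x => ?_⟩
  rw [sub_apply, sub_eq_zero, eq_comm]
  exact Submodule.starProjection_eq_self_iff

theorem norm_sq_sub_norm_sq_of_eq {a b u v : H →L[ℂ] H}
    (h : star a * a - star b * b = star u * u - star v * v) (x : H) :
    ‖a x‖ ^ 2 - ‖b x‖ ^ 2 = ‖u x‖ ^ 2 - ‖v x‖ ^ 2 := by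
  have norm_sq (c : H →L[ℂ] H) : ‖c x‖ ^ 2 = RCLike.re ⟪(star c * c) x, x⟫_ℂ :=
    c.apply_norm_sq_eq_inner_adjoint_left x
  simp only [norm_sq, ← map_sub, ← inner_sub_left, ← sub_apply, h]

/- The decomposition is `a = (√a)² - (√(-a))²`, with `√` vanishing on negative reals. -/
theorem hasSignProjections_toStarSubalgebra (M : VonNeumannAlgebra H) :
    HasSignProjections M.toStarSubalgebra := by
  intro a ha hsa
  have : IsClosed (M.toStarSubalgebra : Set (H →L[ℂ] H)) := M.isClosed_coe
  have mem (f : ℝ → ℝ) : cfc f a ∈ M.toStarSubalgebra := cfc_mem (𝕜' := ℂ) f ha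
  let s : ℝ → ℝ := fun t => √(-t)
  have hs : Continuous s := by fun_prop
  have hsqrt : Continuous Real.sqrt := Real.continuous_sqrt
  have hzero : cfc Real.sqrt a * cfc s a = 0 := by
    have (t : ℝ) : √t * s t = 0 := by
      rcases le_total t 0 with ht | ht
      · rw [Real.sqrt_eq_zero_of_nonpos ht, zero_mul]
      · rw [show s t = 0 from Real.sqrt_eq_zero_of_nonpos (neg_nonpos.mpr ht), mul_zero]
    simp_rw [← cfc_mul Real.sqrt s a hsqrt.continuousOn hs.continuousOn, this, cfc_const_zero]
  have hsub : cfc Real.sqrt a * cfc Real.sqrt a - cfc s a * cfc s a = a := by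
    have (t : ℝ) : √t * √t - s t * s t = t := by
      rcases le_total t 0 with ht | ht
      · simp [s, Real.sqrt_eq_zero_of_nonpos ht, Real.mul_self_sqrt (neg_nonneg.mpr ht)]
      · simp [s, Real.sqrt_eq_zero_of_nonpos (neg_nonpos.mpr ht), Real.mul_self_sqrt ht]
    rw [← cfc_mul .., ← cfc_mul .., ← cfc_sub ..]
    simp_rw [this, cfc_id' ℝ a]
  obtain ⟨e, heM, hsupp⟩ := exists_isSupportProjection M (mem Real.sqrt)
  have he : IsStarProjection e := hsupp.isStarProjection
  have hes : e * cfc s a = 0 := by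
    ext x
    exact (hsupp.apply_eq_zero_iff _).mpr (DFunLike.congr_fun hzero x)
  refine ⟨e, heM, he, cfc Real.sqrt a, mem _, cfc s a, mem _, ?_,
    (hsupp.le_iff he).mp le_rfl, ?_⟩
  · rw [IsSelfAdjoint.cfc.star_eq, IsSelfAdjoint.cfc.star_eq, hsub]
  · simpa only [star_mul, IsSelfAdjoint.cfc.star_eq, he.isSelfAdjoint.star_eq, star_zero]
      using congrArg star hes

end Projections

section Bicommutant
variable {H : Type u} [NormedAddCommGroup H] [InnerProductSpace ℂ H] [CompleteSpace H]

/- An operator of the bicommutant commutes with the projection onto the cyclic subspace. -/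
theorem apply_mem_closure_cyclic (B : StarSubalgebra ℂ (H →L[ℂ] H)) {p : H →L[ℂ] H}
    (hp : p ∈ (B : Set (H →L[ℂ] H)).centralizer.centralizer) (z : H) :
    p z ∈ closure ((fun b : H →L[ℂ] H => b z) '' (B : Set (H →L[ℂ] H))) := by
  let K₀ : Submodule ℂ H :=
    (Subalgebra.toSubmodule B.toSubalgebra).map (ContinuousLinearMap.apply ℂ H z).toLinearMap
  let K : Submodule ℂ H := K₀.topologicalClosure
  have : CompleteSpace K := K₀.isClosed_topologicalClosure.completeSpace_coe
  let P : H →L[ℂ] H := K.starProjection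
  have hP : IsSelfAdjoint P := isStarProjection_starProjection.isSelfAdjoint
  have hfix : ∀ x ∈ K, P x = x := fun x hx => Submodule.starProjection_eq_self_iff.mpr hx
  have hinv : ∀ b ∈ B, ∀ x ∈ K, b x ∈ K := by
    intro b hb x hx
    refine map_mem_closure b.continuous hx ?_
    rintro _ ⟨c, hc, rfl⟩
    exact ⟨b * c, B.mul_mem hb hc, rfl⟩
  have hPb : ∀ b ∈ B, P * b * P = b * P := by
    intro b hb
    ext x
    exact hfix _ (hinv b hb _ (K.starProjection_apply_mem x))
  have hcomm : P ∈ (B : Set (H →L[ℂ] H)).centralizer := by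
    intro b hb
    have h := congrArg star (hPb (star b) (star_mem hb))
    simp only [star_mul, star_star, hP.star_eq] at h
    rw [← hPb b hb, mul_assoc, h]
  have hz : P z = z := hfix z (subset_closure ⟨1, B.one_mem, rfl⟩)
  have hpz : P (p z) = p z := (DFunLike.congr_fun (hp P hcomm) z).trans (congrArg p hz)
  rw [← hpz]
  exact K.starProjection_apply_mem (p z)

variable {B : StarSubalgebra ℂ (H →L[ℂ] H)}

theorem exists_projection_cut (hB : HasSignProjections B) (hcomm : ∀ b ∈ B, ∀ c ∈ B, b * c = c * b)
    {b : H →L[ℂ] H} (hb : b ∈ B) :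
    ∃ q ∈ B, IsStarProjection q ∧ (∀ y, ‖q y‖ ≤ ‖b y‖) ∧ ∀ x, ‖b (x - q x)‖ ≤ ‖x - q x‖ := by
  obtain ⟨q, hqB, hq, u, -, v, -, huv, huq, hvq⟩ := hB (star b * b - star 1 * 1)
    (sub_mem (mul_mem (star_mem hb) hb) (mul_mem (star_mem B.one_mem) B.one_mem))
    ((IsSelfAdjoint.star_mul_self b).sub (IsSelfAdjoint.star_mul_self 1))
  refine ⟨q, hqB, hq, fun y => ?_, fun x => ?_⟩
  · have hv : v (q y) = 0 := DFunLike.congr_fun hvq y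
    have h := norm_sq_sub_norm_sq_of_eq huv (q y)
    rw [hv, norm_zero, one_apply_eq_self] at h
    have hle : ‖q y‖ ≤ ‖b (q y)‖ := by
      rw [← sq_le_sq₀ (norm_nonneg _) (norm_nonneg _)]
      linarith [sq_nonneg ‖u (q y)‖]
    calc ‖q y‖ ≤ ‖b (q y)‖ := hle
      _ = ‖q (b y)‖ := congrArg norm (DFunLike.congr_fun (hcomm b hb q hqB) y)
      _ ≤ ‖b y‖ := norm_projection_apply_le hq _
  · have hu : u (x - q x) = 0 := by
      rw [map_sub, sub_eq_zero]
      exact (DFunLike.congr_fun huq x).symm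
    have h := norm_sq_sub_norm_sq_of_eq huv (x - q x)
    rw [hu, norm_zero, one_apply_eq_self] at h
    rw [← sq_le_sq₀ (norm_nonneg _) (norm_nonneg _)]
    linarith [sq_nonneg ‖v (x - q x)‖]

/- Cut `2b` for an element `b` of `B` that moves `x + y` close to `p (x + y) = x`. -/
theorem exists_projection_norm_le (hB : HasSignProjections B)
    (hcomm : ∀ b ∈ B, ∀ c ∈ B, b * c = c * b) {p : H →L[ℂ] H} (hp : IsStarProjection p)
    (hpB : p ∈ (B : Set (H →L[ℂ] H)).centralizer.centralizer) {x y : H} (hx : p x = x)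
    (hy : p y = 0) {ε : ℝ} (hε : 0 < ε) :
    ∃ q ∈ B, IsStarProjection q ∧ ‖x - q x‖ ≤ ε ∧ ‖q y‖ ≤ ε := by
  have hpz : p (x + y) = x := by rw [map_add, hx, hy, add_zero]
  obtain ⟨_, ⟨b, hb, rfl⟩, hbz⟩ := Metric.mem_closure_iff.mp
    (apply_mem_closure_cyclic B hpB (x + y)) (ε / 2) (half_pos hε)
  rw [hpz, dist_comm, dist_eq_norm] at hbz
  have hpb (z : H) : p (b z) = b (p z) :=
    DFunLike.congr_fun (hpB b fun c hc => hcomm c hc b hb).symm z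
  have hbx : ‖b x - x‖ ≤ ε / 2 := by
    have : p (b (x + y) - x) = b x - x := by rw [map_sub, hpb, hpz, hx]
    exact this ▸ (norm_projection_apply_le hp _).trans hbz.le
  have hby : ‖b y‖ ≤ ε / 2 := by
    have : (1 - p) (b (x + y) - x) = b y := by
      rw [sub_apply, one_apply_eq_self, map_sub p, hpb, hpz, hx, map_add]
      abel
    exact this ▸ (norm_projection_apply_le hp.one_sub _).trans hbz.le
  obtain ⟨q, hqB, hq, hqy, hqx⟩ := exists_projection_cut hB hcomm (B.smul_mem hb 2)
  refine ⟨q, hqB, hq, ?_, ?_⟩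
  · have hle : 2 * ‖b (x - q x)‖ ≤ ‖x - q x‖ := by simpa [norm_smul] using hqx x
    have hqb : b (q x) = q (b x) := DFunLike.congr_fun (hcomm b hb q hqB) x
    have hξ : x - q x = b (x - q x) - (1 - q) (b x - x) := by
      simp only [sub_apply, one_apply_eq_self, map_sub, hqb]
      abel
    have h₁ : ‖x - q x‖ ≤ ‖b (x - q x)‖ + ‖b x - x‖ := by
      conv_lhs => rw [hξ]
      exact (norm_sub_le _ _).trans
        (add_le_add_right (norm_projection_apply_le hq.one_sub _) _)
    linarith
  · have : ‖q y‖ ≤ 2 * ‖b y‖ := by simpa [norm_smul] using hqy y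
    linarith

/- With `w₀ = y` and `wₘ₊₁ = wₘ - qₘ wₘ`, the limit of `w` differs from `y` by at most `∑ εₘ` and is
killed by every `qₘ`. -/
theorem norm_apply_le_tsum {q : ℕ → H →L[ℂ] H} (hq : ∀ m, IsStarProjection (q m))
    (hcomm : ∀ m n, q m * q n = q n * q m) {r : H →L[ℂ] H} (hr : IsStarProjection r)
    (hker : ∀ z, (∀ m, q m z = 0) → r z = 0) {y : H} {ε : ℕ → ℝ} (hε : Summable ε)
    (hle : ∀ m, ‖q m y‖ ≤ ε m) : ‖r y‖ ≤ ∑' m, ε m := by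
  let w : ℕ → H := fun n => Nat.rec y (fun m z => z - q m z) n
  have hw (m n : ℕ) : q m (w (n + 1)) = (1 - q n) (q m (w n)) := by
    change q m (w n - q n (w n)) = q m (w n) - q n (q m (w n))
    rw [map_sub]
    exact congrArg _ (DFunLike.congr_fun (hcomm m n) (w n))
  have hnorm (m n : ℕ) : ‖q m (w n)‖ ≤ ‖q m y‖ := by
    induction n with
    | zero => rfl
    | succ n ih => exact hw m n ▸ (norm_projection_apply_le (hq n).one_sub _).trans ih
  have hzero (m n : ℕ) (hmn : m + 1 ≤ n) : q m (w n) = 0 := by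
    induction n, hmn using Nat.le_induction with
    | base =>
      rw [hw, sub_apply, one_apply_eq_self, projection_apply_apply (hq m), sub_self]
    | succ n _ ih => rw [hw, ih, map_zero]
  have hdist (n : ℕ) : dist (w n) (w (n + 1)) ≤ ε n := by
    rw [dist_eq_norm, show w n - w (n + 1) = q n (w n) from sub_sub_cancel _ _]
    exact (hnorm n n).trans (hle n)
  obtain ⟨v, hv⟩ := cauchySeq_tendsto_of_complete (cauchySeq_of_dist_le_of_summable ε hdist hε)
  have hrv : r v = 0 := hker v fun m => tendsto_nhds_unique
    (((q m).continuous.tendsto v).comp hv) (tendsto_atTop_of_eventually_const (hzero m))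
  calc ‖r y‖ = ‖r (y - v)‖ := by rw [map_sub, hrv, sub_zero]
    _ ≤ ‖y - v‖ := norm_projection_apply_le hr _
    _ ≤ ∑' m, ε m := dist_eq_norm y v ▸ dist_le_tsum_of_dist_le_of_tendsto₀ ε hdist hε hv

/-- A set `B` of operators is projection-complete if every set of projections of `B` has its
supremum, described by its kernel, in `B`. -/
def ProjComplete (B : Set (H →L[ℂ] H)) : Prop :=
  ∀ S ⊆ {q | q ∈ B ∧ IsStarProjection q},
    ∃ g ∈ B, IsStarProjection g ∧ ∀ x, g x = 0 ↔ ∀ q ∈ S, q x = 0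

theorem exists_projection_apply_eq_self_norm_le (hB : HasSignProjections B)
    (hcomm : ∀ b ∈ B, ∀ c ∈ B, b * c = c * b) (hsup : ProjComplete (B : Set (H →L[ℂ] H)))
    {p : H →L[ℂ] H} (hp : IsStarProjection p)
    (hpB : p ∈ (B : Set (H →L[ℂ] H)).centralizer.centralizer) {x y : H} (hx : p x = x)
    (hy : p y = 0) {ε : ℝ} (hε : 0 < ε) :
    ∃ r ∈ B, IsStarProjection r ∧ r x = x ∧ ‖r y‖ ≤ ε := by
  choose q hqB hq hqx hqy using fun m : ℕ =>
    exists_projection_norm_le hB hcomm hp hpB hx hy (ε := ε / 2 / 2 ^ m) (by positivity)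
  obtain ⟨r, hrB, hr, hker⟩ := hsup (Set.range q) (by rintro _ ⟨m, rfl⟩; exact ⟨hqB m, hq m⟩)
  simp only [Set.forall_mem_range] at hker
  refine ⟨r, hrB, hr, ?_, ?_⟩
  · have hrq (m : ℕ) : r * q m = q m :=
      ((hq m).le_iff_mul_eq_right hr).mp
        ((projection_le_iff (hq m) hr).mpr fun z hz => (hker z).mp hz m)
    have hle (m : ℕ) : ‖x - r x‖ ≤ ε / 2 / 2 ^ m := by
      have hrqx : r (q m x) = q m x := DFunLike.congr_fun (hrq m) x
      have : x - r x = (1 - r) (x - q m x) := by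
        rw [sub_apply, one_apply_eq_self, map_sub, hrqx, sub_sub_sub_cancel_right]
      exact this ▸ (norm_projection_apply_le hr.one_sub _).trans (hqx m)
    have hlim := (summable_geometric_two' ε).tendsto_atTop_zero
    exact (sub_eq_zero.mp (norm_le_zero_iff.mp (ge_of_tendsto' hlim hle))).symm
  · rw [← tsum_geometric_two' ε]
    exact norm_apply_le_tsum hq (fun m n => hcomm _ (hqB m) _ (hqB n)) hr (fun z => (hker z).mpr)
      (summable_geometric_two' ε) hqy

theorem exists_projection_le_of_apply_eq_self (hB : HasSignProjections B)
    (hcomm : ∀ b ∈ B, ∀ c ∈ B, b * c = c * b) (hsup : ProjComplete (B : Set (H →L[ℂ] H)))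
    {p : H →L[ℂ] H} (hp : IsStarProjection p)
    (hpB : p ∈ (B : Set (H →L[ℂ] H)).centralizer.centralizer) {x : H} (hx : p x = x) :
    ∃ e ∈ B, IsStarProjection e ∧ e ≤ p ∧ e x = x := by
  obtain ⟨f, hfB, hf, hker⟩ := hsup {q | (q ∈ B ∧ IsStarProjection q) ∧ q x = 0} fun q hq => hq.1
  have hfx : f x = 0 := (hker x).mpr fun q hq => hq.2
  refine ⟨1 - f, sub_mem B.one_mem hfB, hf.one_sub,
    (projection_le_iff hf.one_sub hp).mpr fun y hy => ?_, by simp [hfx]⟩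
  refine norm_le_zero_iff.mp (le_of_forall_pos_le_add fun ε hε => ?_)
  obtain ⟨r, hrB, hr, hrx, hry⟩ :=
    exists_projection_apply_eq_self_norm_le hB hcomm hsup hp hpB hx hy hε
  have hf0 : f ((1 - f) y) = 0 := by simp [projection_apply_apply hf]
  have hr0 : (1 - r) ((1 - f) y) = 0 :=
    (hker _).mp hf0 (1 - r) ⟨⟨sub_mem B.one_mem hrB, hr.one_sub⟩, by simp [hrx]⟩
  calc ‖(1 - f) y‖ = ‖r ((1 - f) y)‖ := by
        rw [sub_apply, one_apply_eq_self, sub_eq_zero] at hr0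
        rw [← hr0]
    _ = ‖(1 - f) (r y)‖ := congrArg norm (DFunLike.congr_fun
        (hcomm r hrB (1 - f) (sub_mem B.one_mem hfB)) y)
    _ ≤ ‖r y‖ := norm_projection_apply_le hf.one_sub _
    _ ≤ 0 + ε := by rwa [zero_add]

/- `p` is the supremum of the projections of `B` below it. -/
theorem projection_mem_of_mem_bicommutant (hB : HasSignProjections B)
    (hcomm : ∀ b ∈ B, ∀ c ∈ B, b * c = c * b) (hsup : ProjComplete (B : Set (H →L[ℂ] H)))
    {p : H →L[ℂ] H} (hp : IsStarProjection p)
    (hpB : p ∈ (B : Set (H →L[ℂ] H)).centralizer.centralizer) : p ∈ B := by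
  obtain ⟨g, hgB, hg, hker⟩ := hsup {q | (q ∈ B ∧ IsStarProjection q) ∧ q ≤ p} fun q hq => hq.1
  suffices h : p = g from h ▸ hgB
  refine le_antisymm ?_ ((projection_le_iff hg hp).mpr fun z hz =>
    (hker z).mpr fun q hq => (projection_le_iff hq.1.2 hp).mp hq.2 z hz)
  refine (projection_le_iff hp hg).mpr fun z hz => ?_
  obtain ⟨e, heB, he, hep, hez⟩ :=
    exists_projection_le_of_apply_eq_self hB hcomm hsup hp hpB (projection_apply_apply hp z)
  have hez0 : e z = 0 := (hker z).mp hz e ⟨⟨heB, he⟩, hep⟩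
  have hmul : e * p = e := (he.le_iff_mul_eq_left hp).mp hep
  rw [← hez, ← hez0]
  exact DFunLike.congr_fun hmul z

end Bicommutant

section ImageContext
variable {H : Type u} [NormedAddCommGroup H] [InnerProductSpace ℂ H] [CompleteSpace H]
variable {A : VonNeumannAlgebra H} (h : A.toStarSubalgebra ≃⋆ₐ[ℂ] A.toStarSubalgebra)

theorem apply_eq_zero_iff_of_isLUB {S : Set (Proj A)} {g : Proj A} (hg : IsLUB S g) (x : H) :
    g.1 x = 0 ↔ ∀ q ∈ S, q.1 x = 0 := by
  constructor
  · exact fun hx q hq => (projection_le_iff q.2.2 g.2.2).mp (hg.1 hq) x hx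
  · intro hx
    let r : H →L[ℂ] H := (ℂ ∙ x).starProjection
    have hr : IsStarProjection (1 - r) := isStarProjection_starProjection.one_sub
    have hker (y : H) : (1 - r) y = 0 ↔ y ∈ ℂ ∙ x := by
      rw [sub_apply, one_apply_eq_self, sub_eq_zero, eq_comm]
      exact Submodule.starProjection_eq_self_iff
    have hle : g.1 ≤ 1 - r := hg.le_of_proj hr fun q hq =>
      (projection_le_iff q.2.2 hr).mpr fun y hy => by
        obtain ⟨c, rfl⟩ := Submodule.mem_span_singleton.mp ((hker y).mp hy)
        rw [map_smul, hx q hq, smul_zero]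
    exact (projection_le_iff g.2.2 hr).mp hle x ((hker x).mpr (Submodule.mem_span_singleton_self x))

namespace Proj

/-- The image `h(p)` of a projection `p` of `A` under a `*`-automorphism `h` of `A`. -/
noncomputable def map (p : Proj A) : Proj A :=
  ⟨h ⟨p.1, p.2.1⟩, (h ⟨p.1, p.2.1⟩).2,
    (((isStarProjection_map_iff A.toStarSubalgebra.subtype Subtype.val_injective
      (p := ⟨p.1, p.2.1⟩)).mp p.2.2).map h).map A.toStarSubalgebra.subtype⟩

theorem map_symm_map (p : Proj A) : map h.symm (map h p) = p := by
  have hp := Subtype.ext_iff.mp (h.symm_apply_apply ⟨p.1, p.2.1⟩)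
  exact Subtype.ext hp

theorem map_le_map_iff {p q : Proj A} : map h p ≤ map h q ↔ p ≤ q := by
  have hmul : h ⟨p.1, p.2.1⟩ * h ⟨q.1, q.2.1⟩ = h ⟨p.1, p.2.1⟩ ↔
      (⟨p.1, p.2.1⟩ : A.toStarSubalgebra) * ⟨q.1, q.2.1⟩ = ⟨p.1, p.2.1⟩ := by
    rw [← map_mul, EmbeddingLike.apply_eq_iff_eq]
  exact ((map h p).2.2.le_iff_mul_eq_left (map h q).2.2).trans
    (Subtype.ext_iff.symm.trans (hmul.trans (Subtype.ext_iff.trans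
      (p.2.2.le_iff_mul_eq_left q.2.2).symm)))

/-- The automorphism of the projection lattice of `A` induced by a `*`-automorphism of `A`. -/
noncomputable def mapIso : Proj A ≃o Proj A where
  toFun := map h
  invFun := map h.symm
  left_inv := map_symm_map h
  right_inv := map_symm_map h.symm
  map_rel_iff' := map_le_map_iff h

end Proj

namespace Context
variable (C : Context A)

/-- A projection of a context, regarded as a projection of `A`. -/
def projIncl (q : Proj C.toVN) : Proj A := ⟨q.1, C.le q.2.1, q.2.2⟩

theorem isLUB_projIncl {S : Set (Proj C.toVN)} {g : Proj C.toVN} (hg : IsLUB S g) :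
    IsLUB (C.projIncl '' S) (C.projIncl g) :=
  ⟨Set.forall_mem_image.mpr fun _ hq => hg.1 hq,
    fun r hr => hg.le_of_proj r.2.2 fun _ hq => hr ⟨_, hq, rfl⟩⟩

/-- The `*`-homomorphism `c ↦ h(c)` from a context to the bounded operators. -/
noncomputable def imageHom : C.alg →⋆ₐ[ℂ] (H →L[ℂ] H) :=
  (A.toStarSubalgebra.subtype.comp (h : A.toStarSubalgebra →⋆ₐ[ℂ] A.toStarSubalgebra)).comp C.inclA

theorem imageHom_injective : Function.Injective (C.imageHom h) :=
  Subtype.val_injective.comp (h.injective.comp (Set.inclusion_injective C.le))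

theorem exists_map_projIncl {p : H →L[ℂ] H} (hp : p ∈ C.imageSet h) (hps : IsStarProjection p) :
    ∃ q : Proj C.toVN, (Proj.map h (C.projIncl q)).1 = p := by
  obtain ⟨c, rfl⟩ := hp
  have hc : IsStarProjection c :=
    (isStarProjection_map_iff (C.imageHom h) (C.imageHom_injective h)).mp hps
  exact ⟨⟨c.1, c.2, hc.map C.alg.subtype⟩, rfl⟩

theorem projComplete_imageSet : ProjComplete (C.imageSet h) := by
  intro S hS
  let S' : Set (Proj C.toVN) := {q | (Proj.map h (C.projIncl q)).1 ∈ S}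
  obtain ⟨g, hg⟩ := exists_isLUB_proj C.toVN S'
  have hlub : IsLUB (Proj.mapIso h '' (C.projIncl '' S')) (Proj.mapIso h (C.projIncl g)) :=
    (Proj.mapIso h).isLUB_image'.mpr (C.isLUB_projIncl hg)
  refine ⟨_, ⟨⟨g.1, g.2.1⟩, rfl⟩, (Proj.mapIso h (C.projIncl g)).2.2, fun x => ?_⟩
  refine (apply_eq_zero_iff_of_isLUB hlub x).trans ?_
  simp only [Set.forall_mem_image]
  constructor
  · intro hx p hp
    obtain ⟨q, rfl⟩ := C.exists_map_projIncl h (hS hp).1 (hS hp).2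
    exact hx hp
  · exact fun hx q hq => hx _ hq

theorem coe_image_eq_imageSet : ((image h C).toVN : Set (H →L[ℂ] H)) = C.imageSet h := by
  have hsub : C.imageSet h ⊆ (image h C).toVN := by
    rw [coe_image]
    exact Set.subset_centralizer_centralizer
  refine subset_antisymm ?_ hsub
  have hclosed : IsClosed ((C.imageHom h).range : Set (H →L[ℂ] H)) :=
    (NonUnitalStarAlgHom.isometry (C.imageHom h)
      (C.imageHom_injective h)).isClosedEmbedding.isClosed_range
  have hsign : HasSignProjections (C.imageHom h).range :=
    (hasSignProjections_toStarSubalgebra C.toVN).range (C.imageHom h) (C.imageHom_injective h)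
  refine (hasSignProjections_toStarSubalgebra (image h C).toVN).le_of_forall_isStarProjection_mem
    hclosed fun p hp hps => ?_
  refine projection_mem_of_mem_bicommutant hsign (C.comm_imageSet h) (C.projComplete_imageSet h)
    hps ?_
  exact (C.coe_image h).le hp

theorem map_mem_image_iff {y : A.toStarSubalgebra} :
    (h y : H →L[ℂ] H) ∈ (image h C).toVN ↔ (y : H →L[ℂ] H) ∈ C.toVN := by
  rw [← SetLike.mem_coe, coe_image_eq_imageSet]
  constructor
  · rintro ⟨c, hc⟩
    rw [← h.injective (Subtype.ext hc)]
    exact c.2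
  · exact fun hy => ⟨⟨y, hy⟩, rfl⟩

theorem image_image_symm : image h (image h.symm C) = C := by
  have hmem (y : A.toStarSubalgebra) :
      (y : H →L[ℂ] H) ∈ (image h (image h.symm C)).toVN ↔ (y : H →L[ℂ] H) ∈ C.toVN := by
    conv_lhs => rw [← h.apply_symm_apply y]
    rw [map_mem_image_iff, map_mem_image_iff]
  exact le_antisymm (fun x hx => (hmem ⟨x, Context.le _ hx⟩).mp hx)
    fun x hx => (hmem ⟨x, C.le hx⟩).mpr hx

/-- The automorphism `C ↦ h[C]` of the poset of contexts. -/
noncomputable def imageIso : Context A ≃o Context A where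
  toFun := image h
  invFun := image h.symm
  left_inv := image_image_symm h.symm
  right_inv := image_image_symm h
  map_rel_iff' {C D} := by
    refine ⟨fun hle => ?_, fun hle => (image h).monotone hle⟩
    rw [← image_image_symm h.symm C, ← image_image_symm h.symm D]
    exact (image h.symm).monotone hle

/-- The isomorphism `q ↦ h(q)` between the projections of `C` and those of `h[C]`. -/
noncomputable def projImage : Proj C.toVN ≃o Proj (image h C).toVN :=
  RelIso.ofSurjective
    (OrderEmbedding.ofMapLEIff
      (fun q => ⟨(Proj.map h (C.projIncl q)).1, (C.map_mem_image_iff h).mpr q.2.1,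
        (Proj.map h (C.projIncl q)).2.2⟩)
      fun q r => Proj.map_le_map_iff h (p := C.projIncl q) (q := C.projIncl r))
    fun p => by
      obtain ⟨q, hq⟩ := C.exists_map_projIncl h ((C.coe_image_eq_imageSet h).le p.2.1) p.2.2
      exact ⟨q, Subtype.ext hq⟩

theorem projImage_outerDas (p : Proj A) :
    C.projImage h (outerDas C.toVN p.1) = outerDas (image h C).toVN (Proj.map h p).1 := by
  have hpre : C.projImage h ⁻¹' {q | (Proj.map h p).1 ≤ q.1} = {q | p.1 ≤ q.1} :=
    Set.ext fun q => Proj.map_le_map_iff h (p := p) (q := C.projIncl q)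
  have hglb := isGLB_outerDas C.toVN p.1
  rw [← hpre, OrderIso.isGLB_preimage] at hglb
  exact hglb.unique (isGLB_outerDas _ _)

theorem projImage_innerDas (p : Proj A) :
    C.projImage h (innerDas C.toVN p.1) = innerDas (image h C).toVN (Proj.map h p).1 := by
  have hpre : C.projImage h ⁻¹' {q | q.1 ≤ (Proj.map h p).1} = {q | q.1 ≤ p.1} :=
    Set.ext fun q => Proj.map_le_map_iff h (p := C.projIncl q) (q := p)
  have hlub := isLUB_innerDas C.toVN p.1
  rw [← hpre, OrderIso.isLUB_preimage] at hlub
  exact hlub.unique (isLUB_innerDas _ _)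

end Context
end ImageContext

section SpectralProjection
variable {H : Type u} [NormedAddCommGroup H] [InnerProductSpace ℂ H]

theorem eq_of_forall_inner_self_eq {S T : H →L[ℂ] H} (h : ∀ x, ⟪x, S x⟫_ℂ = ⟪x, T x⟫_ℂ) :
    S = T := by
  refine ContinuousLinearMap.coe_injective ((ext_inner_map _ _).mp fun x => ?_)
  have hx := congrArg (starRingEnd ℂ) (h x)
  rwa [inner_conj_symm, inner_conj_symm] at hx

variable [CompleteSpace H]

theorem apply_eq_zero_of_inner_self_eq_zero {T : H →L[ℂ] H} (hT : 0 ≤ T) {x : H}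
    (hx : ⟪x, T x⟫_ℂ = 0) : T x = 0 := by
  obtain ⟨s, rfl⟩ := CStarAlgebra.nonneg_iff_eq_star_mul_self.mp hT
  have hs : ⟪x, (star s * s) x⟫_ℂ = ⟪s x, s x⟫_ℂ :=
    ContinuousLinearMap.adjoint_inner_right s x (s x)
  rw [hs, inner_self_eq_zero] at hx
  rw [mul_apply_eq_comp, hx, map_zero]

/- Taking adjoints, `b i * E = b i`, so the range of `1 - E` lies in the kernel of `e`. -/
theorem eq_projection_of_forall_mul_eq {ι : Type*} {e E : H →L[ℂ] H} {b : ι → H →L[ℂ] H}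
    (he : IsStarProjection e) (hE : IsSelfAdjoint E) (hker : ∀ x, e x = 0 → E x = 0)
    (hb : ∀ i, IsSelfAdjoint (b i)) (hbker : ∀ x, (∀ i, b i x = 0) → e x = 0)
    (hEb : ∀ i, E * b i = b i) : E = e := by
  have hbE (i : ι) : b i * E = b i := by
    simpa only [star_mul, hE.star_eq, (hb i).star_eq] using congrArg star (hEb i)
  have heE : e * E = e := by
    ext x
    have hx : e (E x - x) = 0 := hbker _ fun i => by
      rw [map_sub, sub_eq_zero]
      exact DFunLike.congr_fun (hbE i) x
    rwa [map_sub, sub_eq_zero] at hx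
  have hEe : E * e = E := (mul_projection_eq_self_iff he E).mpr hker
  calc E = star (E * e) := by rw [hEe, hE.star_eq]
    _ = e := by rw [star_mul, he.isSelfAdjoint.star_eq, hE.star_eq, heE]

variable {a : H →L[ℂ] H} {Δ : Set ℝ}

theorem vectorSpectralMeasure_real_univ (ha : IsSelfAdjoint a) (x : H) :
    (vectorSpectralMeasure a x).real Set.univ = ‖x‖ ^ 2 := by
  refine le_antisymm ?_ ?_
  · exact ENNReal.toReal_le_of_le_ofReal (by positivity) (vectorSpectralMeasure_univ_le a x)
  · have hK : IsCompact (spectrum ℝ a) := ContinuousFunctionalCalculus.isCompact_spectrum a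
    obtain ⟨f, hf_one, hf_supp, -, hf_mem⟩ :=
      exists_continuousMap_one_of_isCompact_subset_isOpen hK isOpen_univ (Set.subset_univ _)
    let g : C_c(ℝ, ℝ) := ⟨f, hasCompactSupport_def.mpr hf_supp⟩
    have hg : cfc (g : ℝ → ℝ) a = 1 := (cfc_congr hf_one).trans (cfc_const_one ℝ a)
    calc ‖x‖ ^ 2 = (⟪x, x⟫_ℂ).re := (inner_self_eq_norm_sq (𝕜 := ℂ) x).symm
      _ = ∫ t, g t ∂(vectorSpectralMeasure a x) := by
        rw [integral_vectorSpectralMeasure, hg, one_apply_eq_self]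
      _ ≤ ∫ _, (1 : ℝ) ∂(vectorSpectralMeasure a x) :=
        integral_mono g.integrable (integrable_const 1) fun t => (hf_mem t).2
      _ = (vectorSpectralMeasure a x).real Set.univ := by rw [integral_const, smul_eq_mul, mul_one]

theorem spectralProjection_univ (ha : IsSelfAdjoint a) : spectralProjection a Set.univ = 1 := by
  refine eq_of_forall_inner_self_eq fun x => ?_
  rw [inner_spectralProjection, vectorSpectralMeasure_real_univ ha, one_apply_eq_self,
    inner_self_eq_norm_sq_to_K]
  simp

theorem spectralProjection_empty (a : H →L[ℂ] H) : spectralProjection a ∅ = 0 := by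
  refine eq_of_forall_inner_self_eq fun x => ?_
  rw [inner_spectralProjection]
  simp

theorem spectralProjection_compl (ha : IsSelfAdjoint a) (hΔ : MeasurableSet Δ) :
    spectralProjection a Δᶜ = 1 - spectralProjection a Δ := by
  refine eq_of_forall_inner_self_eq fun x => ?_
  rw [sub_apply, inner_sub_right, ← spectralProjection_univ ha]
  simp only [inner_spectralProjection]
  rw [measureReal_compl hΔ, Complex.ofReal_sub]

theorem spectralProjection_nonneg (a : H →L[ℂ] H) (Δ : Set ℝ) : 0 ≤ spectralProjection a Δ := by
  rw [ContinuousLinearMap.nonneg_iff_isPositive, ContinuousLinearMap.isPositive_iff_complex]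
  intro x
  rw [← inner_conj_symm, inner_spectralProjection, Complex.conj_ofReal]
  exact ⟨rfl, measureReal_nonneg⟩

theorem isSelfAdjoint_spectralProjection (a : H →L[ℂ] H) (Δ : Set ℝ) :
    IsSelfAdjoint (spectralProjection a Δ) :=
  .of_nonneg (spectralProjection_nonneg a Δ)

theorem spectralProjection_apply_eq_zero_iff {x : H} :
    spectralProjection a Δ x = 0 ↔ vectorSpectralMeasure a x Δ = 0 := by
  rw [← measureReal_eq_zero_iff, ← Complex.ofReal_eq_zero, ← inner_spectralProjection]
  exact ⟨fun hx => by rw [hx, inner_zero_right],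
    apply_eq_zero_of_inner_self_eq_zero (spectralProjection_nonneg a Δ)⟩

theorem spectralProjection_apply_eq_self_iff (ha : IsSelfAdjoint a) (hΔ : MeasurableSet Δ)
    {x : H} : spectralProjection a Δ x = x ↔ vectorSpectralMeasure a x Δᶜ = 0 := by
  rw [← spectralProjection_apply_eq_zero_iff, spectralProjection_compl ha hΔ, sub_apply,
    one_apply_eq_self, sub_eq_zero, eq_comm]

theorem integral_vectorSpectralMeasure_cfc_apply (a : H →L[ℂ] H) (f g : C_c(ℝ, ℝ)) (y : H) :
    ∫ t, g t ∂(vectorSpectralMeasure a (cfc (f : ℝ → ℝ) a y)) =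
      ∫ t, f t ^ 2 * g t ∂(vectorSpectralMeasure a y) := by
  have hf : IsSelfAdjoint (cfc (f : ℝ → ℝ) a) := cfc_predicate _ a
  have hmul : cfc ((f * (g * f) : C_c(ℝ, ℝ)) : ℝ → ℝ) a =
      cfc (f : ℝ → ℝ) a * (cfc (g : ℝ → ℝ) a * cfc (f : ℝ → ℝ) a) := by
    rw [← cfc_mul g f a g.continuous.continuousOn f.continuous.continuousOn,
      ← cfc_mul f (fun t => g t * f t) a f.continuous.continuousOn
        (g.continuous.mul f.continuous).continuousOn]
    rfl
  calc ∫ t, g t ∂(vectorSpectralMeasure a (cfc (f : ℝ → ℝ) a y))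
      = (⟪y, cfc ((f * (g * f) : C_c(ℝ, ℝ)) : ℝ → ℝ) a y⟫_ℂ).re := by
        rw [integral_vectorSpectralMeasure, hmul, ← ContinuousLinearMap.adjoint_inner_right,
          ← ContinuousLinearMap.star_eq_adjoint, hf.star_eq]
        rfl
    _ = ∫ t, f t * (g t * f t) ∂(vectorSpectralMeasure a y) :=
        (integral_vectorSpectralMeasure a y (f * (g * f))).symm
    _ = ∫ t, f t ^ 2 * g t ∂(vectorSpectralMeasure a y) := by
        congr 1 with t
        ring

theorem vectorSpectralMeasure_cfc_apply (a : H →L[ℂ] H) (f : C_c(ℝ, ℝ)) (y : H) :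
    vectorSpectralMeasure a (cfc (f : ℝ → ℝ) a y) =
      (vectorSpectralMeasure a y).withDensity fun t => ENNReal.ofReal (f t ^ 2) := by
  have hint : Integrable (fun t => f t ^ 2) (vectorSpectralMeasure a y) := by
    simp_rw [sq]
    exact (f * f).integrable
  have : IsFiniteMeasure
      ((vectorSpectralMeasure a y).withDensity fun t => ENNReal.ofReal (f t ^ 2)) :=
    isFiniteMeasure_withDensity_ofReal hint.2
  refine Measure.ext_of_integral_eq_on_compactlySupported fun g => ?_
  rw [integral_vectorSpectralMeasure_cfc_apply]
  refine Eq.trans ?_ (integral_withDensity_eq_integral_smul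
    (f.continuous.pow 2).measurable.real_toNNReal g).symm
  congr 1 with t
  exact congrArg (· * g t) (Real.coe_toNNReal _ (sq_nonneg (f t))).symm

theorem spectralProjection_support_mul_cfc (ha : IsSelfAdjoint a) (f : C_c(ℝ, ℝ)) :
    spectralProjection a (Function.support f) * cfc (f : ℝ → ℝ) a = cfc (f : ℝ → ℝ) a := by
  have hΔ : MeasurableSet (Function.support f) := f.continuous.isOpen_support.measurableSet
  ext y
  have hzero : vectorSpectralMeasure a (cfc (f : ℝ → ℝ) a y) (Function.support f)ᶜ = 0 := by
    rw [vectorSpectralMeasure_cfc_apply, withDensity_apply _ hΔ.compl]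
    refine setLIntegral_eq_zero hΔ.compl fun t ht => ?_
    rw [Function.notMem_support.mp ht, zero_pow two_ne_zero, ENNReal.ofReal_zero, Pi.zero_apply]
  exact (spectralProjection_apply_eq_self_iff ha hΔ).mpr hzero

theorem spectralProjection_support (ha : IsSelfAdjoint a) (f : C_c(ℝ, ℝ)) (hf : ∀ t, 0 ≤ f t)
    {e : H →L[ℂ] H} (he : IsSupportProjection e (cfc (f : ℝ → ℝ) a)) :
    spectralProjection a (Function.support f) = e := by
  refine eq_projection_of_forall_mul_eq (b := fun _ : Unit => cfc (f : ℝ → ℝ) a)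
    he.isStarProjection (isSelfAdjoint_spectralProjection a _) (fun x hx => ?_)
    (fun _ => cfc_predicate _ a) (fun x hx => (he.apply_eq_zero_iff x).mpr (hx ()))
    fun _ => spectralProjection_support_mul_cfc ha f
  have hint := integral_vectorSpectralMeasure a x f
  rw [(he.apply_eq_zero_iff x).mp hx, inner_zero_right, Complex.zero_re,
    integral_eq_zero_iff_of_nonneg hf f.integrable] at hint
  exact spectralProjection_apply_eq_zero_iff.mpr hint

theorem spectralProjection_iUnion {A : VonNeumannAlgebra H} (ha : IsSelfAdjoint a)
    {Δ : ℕ → Set ℝ} (hΔ : ∀ i, MeasurableSet (Δ i)) {p : ℕ → Proj A}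
    (hp : ∀ i, spectralProjection a (Δ i) = (p i).1) {P : Proj A} (hP : IsLUB (Set.range p) P) :
    spectralProjection a (⋃ i, Δ i) = P.1 := by
  have hker (x : H) : P.1 x = 0 ↔ ∀ i, (p i).1 x = 0 :=
    (apply_eq_zero_iff_of_isLUB hP x).trans Set.forall_mem_range
  refine eq_projection_of_forall_mul_eq P.2.2 (isSelfAdjoint_spectralProjection a _)
    (fun x hx => ?_) (fun i => (p i).2.2.isSelfAdjoint) (fun x => (hker x).mpr)
    fun i => ContinuousLinearMap.ext fun y => ?_
  · refine spectralProjection_apply_eq_zero_iff.mpr (measure_iUnion_null fun i => ?_)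
    rw [← spectralProjection_apply_eq_zero_iff, hp]
    exact (hker x).mp hx i
  · refine (spectralProjection_apply_eq_self_iff ha (.iUnion hΔ)).mpr ?_
    refine measure_mono_null (Set.compl_subset_compl.mpr (Set.subset_iUnion Δ i)) ?_
    rw [← spectralProjection_apply_eq_self_iff ha (hΔ i), hp]
    exact projection_apply_apply (p i).2.2 y

end SpectralProjection

section SpectralProjectionAutomorphism
variable {H : Type u} [NormedAddCommGroup H] [InnerProductSpace ℂ H] [CompleteSpace H]
variable {A : VonNeumannAlgebra H} (h : A.toStarSubalgebra ≃⋆ₐ[ℂ] A.toStarSubalgebra)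

theorem coe_map_eq_cfc {a b : A.toStarSubalgebra} (ha : IsSelfAdjoint a) {f : ℝ → ℝ}
    (hf : Continuous f) (hb : (b : H →L[ℂ] H) = cfc f (a : H →L[ℂ] H)) :
    (h b : H →L[ℂ] H) = cfc f (h a : H →L[ℂ] H) := by
  have : IsClosed (A.toStarSubalgebra : Set (H →L[ℂ] H)) := A.isClosed_coe
  have hcoe (c : A.toStarSubalgebra) (hc : IsSelfAdjoint c) :
      ((cfc f c : A.toStarSubalgebra) : H →L[ℂ] H) = cfc f (c : H →L[ℂ] H) :=
    StarAlgHom.map_cfc A.toStarSubalgebra.subtype f c hf.continuousOn continuous_subtype_val hc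
      (hc.map A.toStarSubalgebra.subtype)
  have hmap : h (cfc f a) = cfc f (h a) :=
    StarAlgHomClass.map_cfc h f a hf.continuousOn
      (NonUnitalStarAlgHom.isometry h h.injective).continuous ha (ha.map h)
  rw [← hcoe a ha, ← Subtype.ext_iff] at hb
  rw [hb, hmap, hcoe _ (ha.map h)]

theorem isSupportProjection_iff_forall_le_iff {b : H →L[ℂ] H} (hb : b ∈ A) (e : Proj A) :
    IsSupportProjection e.1 b ↔ ∀ q : Proj A, e ≤ q ↔ b * q.1 = b := by
  refine ⟨fun he q => he.le_iff q.2.2, fun he => ?_⟩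
  obtain ⟨s, hsA, hs⟩ := exists_isSupportProjection A hb
  have hes : e = ⟨s, hsA, hs.isStarProjection⟩ :=
    eq_of_forall_ge_iff fun q => (he q).trans (hs.le_iff q.2.2).symm
  exact hes ▸ hs

theorem IsSupportProjection.map {b : A.toStarSubalgebra} {e : Proj A}
    (he : IsSupportProjection e.1 b) : IsSupportProjection (Proj.map h e).1 (h b) := by
  rw [isSupportProjection_iff_forall_le_iff b.2] at he
  rw [isSupportProjection_iff_forall_le_iff (h b).2, (Proj.mapIso h).surjective.forall]
  intro q
  have hmul : h b * h ⟨q.1, q.2.1⟩ = h b ↔ b * ⟨q.1, q.2.1⟩ = b := by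
    rw [← map_mul, EmbeddingLike.apply_eq_iff_eq]
  exact (Proj.map_le_map_iff h).trans ((he q).trans
    (Subtype.ext_iff.symm.trans (hmul.symm.trans Subtype.ext_iff)))

theorem exists_compactlySupported_support_eq {E : Type*} [NormedAddCommGroup E] [NormedSpace ℝ E]
    [FiniteDimensional ℝ E] {s : Set E} (hs : IsOpen s) (hb : Bornology.IsBounded s) :
    ∃ f : C_c(E, ℝ), (∀ t, 0 ≤ f t) ∧ Function.support f = s := by
  obtain ⟨f, hf, hcont, hrange⟩ := hs.exists_contDiff_support_eq (n := 0)
  have := FiniteDimensional.proper ℝ E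
  exact ⟨⟨⟨f, hcont.continuous⟩, (hf ▸ hb).isCompact_closure⟩,
    fun t => (hrange ⟨t, rfl⟩).1, hf⟩

variable {a : A.toStarSubalgebra} {Δ : Set ℝ}

theorem exists_proj_spectralProjection_of_isOpen (ha : IsSelfAdjoint a) (hΔ : IsOpen Δ)
    (hb : Bornology.IsBounded Δ) :
    ∃ p : Proj A, spectralProjection (a : H →L[ℂ] H) Δ = p.1 ∧
      spectralProjection (h a : H →L[ℂ] H) Δ = (Proj.map h p).1 := by
  obtain ⟨f, hf, rfl⟩ := exists_compactlySupported_support_eq hΔ hb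
  have : IsClosed (A.toStarSubalgebra : Set (H →L[ℂ] H)) := A.isClosed_coe
  have hmem : cfc (f : ℝ → ℝ) (a : H →L[ℂ] H) ∈ A.toStarSubalgebra := cfc_mem (𝕜' := ℂ) _ a.2
  obtain ⟨e, heA, he⟩ := exists_isSupportProjection A hmem
  let p : Proj A := ⟨e, heA, he.isStarProjection⟩
  have hhp : IsSupportProjection (Proj.map h p).1 (cfc (f : ℝ → ℝ) (h a : H →L[ℂ] H)) :=
    coe_map_eq_cfc h ha f.continuous (b := ⟨_, hmem⟩) rfl ▸ he.map h
  exact ⟨p, spectralProjection_support (ha.map A.toStarSubalgebra.subtype) f hf he,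
    spectralProjection_support ((ha.map h).map A.toStarSubalgebra.subtype) f hf hhp⟩

theorem exists_proj_spectralProjection (ha : IsSelfAdjoint a) (hΔ : MeasurableSet Δ) :
    ∃ p : Proj A, spectralProjection (a : H →L[ℂ] H) Δ = p.1 ∧
      spectralProjection (h a : H →L[ℂ] H) Δ = (Proj.map h p).1 := by
  have ha' : IsSelfAdjoint (a : H →L[ℂ] H) := ha.map A.toStarSubalgebra.subtype
  have hha : IsSelfAdjoint (h a : H →L[ℂ] H) := (ha.map h).map A.toStarSubalgebra.subtype
  induction Δ, hΔ using MeasurableSpace.induction_on_inter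
    (BorelSpace.measurable_eq.trans Real.borel_eq_generateFrom_Ioo_rat)
    Real.isPiSystem_Ioo_rat with
  | empty =>
    have hzero : h 0 = 0 := map_zero h
    exact ⟨⟨0, zero_mem A, .zero _⟩, spectralProjection_empty _,
      (spectralProjection_empty _).trans (Subtype.ext_iff.mp hzero).symm⟩
  | basic Δ hΔ =>
    simp only [Set.mem_iUnion, Set.mem_singleton_iff] at hΔ
    obtain ⟨l, u, -, rfl⟩ := hΔ
    exact exists_proj_spectralProjection_of_isOpen h ha isOpen_Ioo (Metric.isBounded_Ioo _ _)
  | compl Δ hΔ ih =>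
    obtain ⟨p, hp, hhp⟩ := ih
    have hcompl : h (1 - ⟨p.1, p.2.1⟩) = 1 - h ⟨p.1, p.2.1⟩ := by rw [map_sub, map_one]
    refine ⟨⟨1 - p.1, sub_mem (one_mem A) p.2.1, p.2.2.one_sub⟩, ?_, ?_⟩
    · rw [spectralProjection_compl ha' hΔ, hp]
    · rw [spectralProjection_compl hha hΔ, hhp]
      exact (Subtype.ext_iff.mp hcompl).symm
  | iUnion Δ _ hΔ ih =>
    choose p hp hhp using ih
    obtain ⟨P, hP⟩ := exists_isLUB_proj A (Set.range p)
    have hhP : IsLUB (Set.range fun i => Proj.map h (p i)) (Proj.map h P) := by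
      have := (Proj.mapIso h).isLUB_image'.mpr hP
      rwa [← Set.range_comp] at this
    exact ⟨P, spectralProjection_iUnion ha' hΔ hp hP, spectralProjection_iUnion hha hΔ hhp hhP⟩

end SpectralProjectionAutomorphism

section Forcing
variable {H : Type u} [NormedAddCommGroup H] [InnerProductSpace ℂ H] [CompleteSpace H]
variable {A : VonNeumannAlgebra H} (h : A.toStarSubalgebra ≃⋆ₐ[ℂ] A.toStarSubalgebra)

namespace Context

/-- The open set `{λ | λ(q) = 1}` of the Gelfand spectrum of a context. -/
def specOpen (C : Context A) (q : Proj C.toVN) : Opens C.Spec :=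
  ⟨C.specSet q, C.isOpen_specSet q⟩

theorem contravariant_forces_elementary_iff (ψ : State A) (a : A.toStarSubalgebra) (Δ : Set ℝ)
    (C : Context A) :
    Contravariant.Forces C (Contravariant.elementary a Δ ≫ Contravariant.valuation ψ OrderHom.id)
        (Contravariant.lowerOne A) ↔
      ∀ D ≤ C, ψ.localValuation D
        (D.specOpen (outerDas D.toVN (spectralProjection (a : H →L[ℂ] H) Δ))) = 1 :=
  Subtype.ext_iff.trans (funext_iff.trans Subtype.forall)

theorem covariant_forces_elementary_iff (ψ : State A) (a : A.toStarSubalgebra) (Δ : Set ℝ)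
    (C : Context A) :
    Covariant.Forces C (Covariant.elementary a Δ ≫ Covariant.valuation ψ OrderHom.id)
        (Covariant.lowerOne A) ↔
      ∀ D ≥ C, ψ.localValuation D
        (D.specOpen (innerDas D.toVN (spectralProjection (a : H →L[ℂ] H) Δ))) = 1 :=
  Subtype.ext_iff.trans (funext_iff.trans Subtype.forall)

theorem contravariant_forces_invImage_iff (ψ : State A) (a : A.toStarSubalgebra) (Δ : Set ℝ)
    (C : Context A) :
    Contravariant.Forces C (Contravariant.elementary a Δ ≫ Contravariant.invImage h ≫
        Contravariant.valuation ψ (image h)) (Contravariant.lowerOne A) ↔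
      ∀ D ≤ C, ψ.localValuation (image h D) ((image h D).specOpen
        (D.projImage h (outerDas D.toVN (spectralProjection (a : H →L[ℂ] H) Δ)))) = 1 :=
  Subtype.ext_iff.trans (funext_iff.trans Subtype.forall)

theorem covariant_forces_invImage_iff (ψ : State A) (a : A.toStarSubalgebra) (Δ : Set ℝ)
    (C : Context A) :
    Covariant.Forces C (Covariant.elementary a Δ ≫ Covariant.invImage h ≫
        Covariant.valuation ψ (image h)) (Covariant.lowerOne A) ↔
      ∀ D ≥ C, ψ.localValuation (image h D) ((image h D).specOpen
        (D.projImage h (innerDas D.toVN (spectralProjection (a : H →L[ℂ] H) Δ)))) = 1 :=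
  Subtype.ext_iff.trans (funext_iff.trans Subtype.forall)

variable {a : A.toStarSubalgebra} {Δ : Set ℝ}

theorem contravariant_forces_iff_forces_image (ψ : State A) (ha : IsSelfAdjoint a)
    (hΔ : MeasurableSet Δ) (C : Context A) :
    Contravariant.Forces C (Contravariant.elementary a Δ ≫ Contravariant.invImage h ≫
        Contravariant.valuation ψ (image h)) (Contravariant.lowerOne A) ↔
      Contravariant.Forces (image h C)
        (Contravariant.elementary (h a) Δ ≫ Contravariant.valuation ψ OrderHom.id)
        (Contravariant.lowerOne A) := by
  obtain ⟨p, hp, hhp⟩ := exists_proj_spectralProjection h ha hΔ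
  rw [contravariant_forces_invImage_iff, contravariant_forces_elementary_iff, hp, hhp]
  refine .trans (forall_congr' fun D => ?_) (imageIso h).surjective.forall.symm
  refine imp_congr ((imageIso h).le_iff_le (x := D) (y := C)).symm ?_
  rw [projImage_outerDas]
  rfl

theorem covariant_forces_iff_forces_image (ψ : State A) (ha : IsSelfAdjoint a)
    (hΔ : MeasurableSet Δ) (C : Context A) :
    Covariant.Forces C (Covariant.elementary a Δ ≫ Covariant.invImage h ≫
        Covariant.valuation ψ (image h)) (Covariant.lowerOne A) ↔
      Covariant.Forces (image h C)
        (Covariant.elementary (h a) Δ ≫ Covariant.valuation ψ OrderHom.id)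
        (Covariant.lowerOne A) := by
  obtain ⟨p, hp, hhp⟩ := exists_proj_spectralProjection h ha hΔ
  rw [covariant_forces_invImage_iff, covariant_forces_elementary_iff, hp, hhp]
  refine .trans (forall_congr' fun D => ?_) (imageIso h).surjective.forall.symm
  refine imp_congr ((imageIso h).le_iff_le (x := C) (y := D)).symm ?_
  rw [projImage_innerDas]
  rfl

theorem image_image_eq {S T : Set (Context A)} (hST : ∀ C, C ∈ S ↔ image h C ∈ T) :
    image h '' S = T := by
  rw [Set.ext hST]
  exact Set.image_preimage_eq T (imageIso h).surjective

end Context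
end Forcing

theorem theorem5p18 {H : Type u} [NormedAddCommGroup H] [InnerProductSpace ℂ H] [CompleteSpace H]
    (A : VonNeumannAlgebra H) (h : A.toStarSubalgebra ≃⋆ₐ[ℂ] A.toStarSubalgebra) (ψ : State A)
    (a : A.toStarSubalgebra) (ha : IsSelfAdjoint a) (Δ : Set ℝ) (hΔ : MeasurableSet Δ) :
    -- the context `ĥ(C)` is the set `h[C]`
    (∀ C : Context A, ((Context.image h C).toVN : Set (H →L[ℂ] H)) = C.imageSet h) ∧
    -- contravariant model
    (∀ C : Context A,
      Contravariant.Forces C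
        (Contravariant.elementary a Δ ≫ Contravariant.invImage h ≫
          Contravariant.valuation ψ (Context.image h)) (Contravariant.lowerOne A) ↔
      Contravariant.Forces (Context.image h C)
        (Contravariant.elementary (h a) Δ ≫ Contravariant.valuation ψ OrderHom.id)
        (Contravariant.lowerOne A)) ∧
    (Context.image h '' (Contravariant.truthValue
        (Contravariant.elementary a Δ ≫ Contravariant.invImage h ≫
          Contravariant.valuation ψ (Context.image h)) (Contravariant.lowerOne A) :
            Set (Context A)) =
      (Contravariant.truthValue
        (Contravariant.elementary (h a) Δ ≫ Contravariant.valuation ψ OrderHom.id)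
        (Contravariant.lowerOne A) : Set (Context A))) ∧
    -- covariant model
    (∀ C : Context A,
      Covariant.Forces C
        (Covariant.elementary a Δ ≫ Covariant.invImage h ≫
          Covariant.valuation ψ (Context.image h)) (Covariant.lowerOne A) ↔
      Covariant.Forces (Context.image h C)
        (Covariant.elementary (h a) Δ ≫ Covariant.valuation ψ OrderHom.id)
        (Covariant.lowerOne A)) ∧
    (Context.image h '' (Covariant.truthValue
        (Covariant.elementary a Δ ≫ Covariant.invImage h ≫
          Covariant.valuation ψ (Context.image h)) (Covariant.lowerOne A) :
            Set (Context A)) =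
      (Covariant.truthValue
        (Covariant.elementary (h a) Δ ≫ Covariant.valuation ψ OrderHom.id)
        (Covariant.lowerOne A) : Set (Context A))) := by
  have h₁ := Context.contravariant_forces_iff_forces_image h ψ ha hΔ
  have h₂ := Context.covariant_forces_iff_forces_image h ψ ha hΔ
  exact ⟨Context.coe_image_eq_imageSet h, h₁, Context.image_image_eq h h₁, h₂,
    Context.image_image_eq h h₂⟩
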